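/- Let $0<T\le\infty$ and let $X:S^1\times[0,T)\to\mathbb{R}^2$ ($S^1=\mathbb{R}/2\pi\mathbb{Z}$) be a smooth family of regular closed plane curves with nowhere vanishing curvature which evolves by $$\frac{\partial X}{\partial t}=\eta\,\mathbf{T}+\Big(\kappa-\frac{\lambda(t)}{\kappa}\Big)N,\qquad \lambda(t)=\frac{2\pi}{\oint\frac1\kappa\,ds},$$ where $\mathbf{T}$ is the unit tangent, $N$ the unit normal to its left, $\kappa$ the curvature with respect to $N$, $s$ arc length, and the tangential speed $\eta=\eta(u,t)$ is arbitrary (it affects only the parametrization; $\eta=0$ is the flow in normal direction). Suppose that the initial curve $X(\cdot,0)$ is a simple, counterclockwise, strictly convex closed curve (it lies to the left of each of its tangent lines, and $\kappa>0$). Let $L(t)=\oint ds$ and $A(t)=\frac12\oint x\,dy-y\,dx$ be the length of and the area enclosed by $X(\cdot,t)$. Then $A(0)>0$, and: 1. The isoperimetric deficit $L^2-4\pi A$ is nonnegative and nonincreasing on $[0,T)$, and strictly decreasing as long as it is positive: if $s<t$ and $L(s)^2-4\pi A(s)>0$, then $L(t)^2-4\pi A(t)<L(s)^2-4\pi A(s)$.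 2. It decays exponentially: for all $t\in[0,T)$, $$L(t)^2-4\pi A(t)\le\big(L(0)^2-4\pi A(0)\big)\,e^{-2\pi t/A(0)};$$ in particular, if $L(0)\ge\frac12$, then $L(t)^2-4\pi A(t)\le\big(L(0)^2-4\pi A(0)\big)\,e^{-\pi t/(A(0)L(0))}$ for all $t\in[0,T)$. 3. If no singularities form, i.e. if $T=\infty$, then $L(t)^2-4\pi A(t)\to0$ as $t\to\infty$, and there is a point $c\in\mathbb{R}^2$ such that the curves $X(S^1,t)$ converge in the Hausdorff metric, as $t\to\infty$, to the circle of radius $\sqrt{A(0)/\pi}$ centred at $c$. -/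

import Mathlib

open Set Filter Topology MeasureTheory
open scoped ContDiff

noncomputable section

namespace CurveFlow

/-- The Euclidean plane. -/
abbrev Plane : Type := EuclideanSpace ℝ (Fin 2)

/-- Counterclockwise rotation of the plane by a right angle. -/
def rot (v : Plane) : Plane := !₂[-v 1, v 0]

/-! Geometry of a closed plane curve, given as a `2π`-periodic map `γ : ℝ → Plane`,
that is, a map on the circle `ℝ / 2πℤ`. -/

/-- The metric `g = |γ_u|`, so that `ds = g du`. -/
def metric (γ : ℝ → Plane) (u : ℝ) : ℝ := ‖deriv γ u‖

/-- The unit tangent vector `T = (1 / g) γ_u`. -/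
def tangent (γ : ℝ → Plane) (u : ℝ) : Plane := (metric γ u)⁻¹ • deriv γ u

/-- The unit normal vector, to the left of `T`. It is the inward normal of a counterclockwise
convex curve, and equals `(1 / κ) T_s` where `κ ≠ 0`. -/
def normal (γ : ℝ → Plane) (u : ℝ) : Plane := rot (tangent γ u)

/-- The signed curvature: `T_s = κ N` with `T_s = (1 / g) T_u`, so `κ = ⟨T_s, N⟩`, which is the
arc-length derivative of the direction angle of `T`. -/
def curvature (γ : ℝ → Plane) (u : ℝ) : ℝ :=
  inner ℝ ((metric γ u)⁻¹ • deriv (tangent γ) u) (normal γ u)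

/-- The length `L = ∮ ds`. -/
def length (γ : ℝ → Plane) : ℝ := ∫ u in (0 : ℝ)..(2 * Real.pi), metric γ u

/-- The enclosed (algebraic) area `A = ½ ∮ x dy - y dx`. -/
def area (γ : ℝ → Plane) : ℝ :=
  1 / 2 * ∫ u in (0 : ℝ)..(2 * Real.pi), (γ u 0 * deriv γ u 1 - γ u 1 * deriv γ u 0)

/-- The isoperimetric deficit `L² - 4πA`. -/
def deficit (γ : ℝ → Plane) : ℝ := length γ ^ 2 - 4 * Real.pi * area γ

/-- The nonlocal term `λ = 2π / ∮ (1 / κ) ds`. -/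
def nonlocalTerm (γ : ℝ → Plane) : ℝ :=
  2 * Real.pi / ∫ u in (0 : ℝ)..(2 * Real.pi), 1 / curvature γ u * metric γ u

/-- A smooth regular simple closed curve, counterclockwise, which is convex (it lies on the left
of each of its tangent lines) and whose curvature is positive. -/
structure IsStrictlyConvexClosed (γ : ℝ → Plane) : Prop where
  smooth : ContDiff ℝ ∞ γ
  periodic : Function.Periodic γ (2 * Real.pi)
  regular : ∀ u, deriv γ u ≠ 0
  simple : InjOn γ (Ico 0 (2 * Real.pi))
  convex : ∀ u v, 0 ≤ inner ℝ (γ v - γ u) (normal γ u)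
  curvature_pos : ∀ u, 0 < curvature γ u

/-- The time interval `[0, T)`, where `T = ⊤` is allowed. -/
def timeInterval (T : EReal) : Set ℝ := {t : ℝ | 0 ≤ t ∧ (t : EReal) < T}

/-- `X : S¹ × [0, T) → ℝ²` is a smooth family of regular closed curves that solves
`X_t = η T + (κ - λ / κ) N` with `λ = 2π / ∮ (1 / κ) ds`. The tangential speed `η` is arbitrary, as
it only affects the parametrization: `η = 0` is the flow in the normal direction, and another choice
keeps the direction angle independent of time. The curvature does not vanish, since the equation
contains `1 / κ`. -/
structure IsFlow (T : EReal) (X : ℝ → ℝ → Plane) : Prop where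
  smooth : ContDiffOn ℝ ∞ (fun p : ℝ × ℝ => X p.1 p.2) (univ ×ˢ timeInterval T)
  periodic : ∀ t ∈ timeInterval T, Function.Periodic (fun u => X u t) (2 * Real.pi)
  regular : ∀ t ∈ timeInterval T, ∀ u, deriv (fun v => X v t) u ≠ 0
  curvature_ne_zero : ∀ t ∈ timeInterval T, ∀ u, curvature (fun v => X v t) u ≠ 0
  evolution : ∃ η : ℝ → ℝ → ℝ, ∀ t ∈ timeInterval T, ∀ u,
    HasDerivWithinAt (fun τ => X u τ)
      (η u t • tangent (fun v => X v t) u +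
        (curvature (fun v => X v t) u
            - nonlocalTerm (fun v => X v t) / curvature (fun v => X v t) u) •
          normal (fun v => X v t) u)
      (timeInterval T) t

end CurveFlow

end

/-! Along the flow the area is constant, and the length satisfies
`L' = λ L - ∮ κ² ds = 2πL / ∮ (1/κ) ds - ∮ κ² ds`. With Gage's inequality `∮ κ² ds ≥ πL / A` and
the Green–Osher inequality `∮ (1/κ) ds ≥ (L² - 2πA) / π`, this gives
`(L² - 4πA)' ≤ -(2π / A) (L² - 4πA)`.

Both inequalities come from Bonnesen's inequality. The curve is cut into two halves of equal area by
a chord whose end tangents are parallel. On each half the support function `h` about the midpoint of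
the chord, as a function of the direction angle, is a half-period on which Wirtinger's inequality
applies, and this bounds `∫ h² ds` and `∫ h² dθ` over the half.

The position converges because the Steiner point moves with speed at most `-L' / π`, so that it
converges along with the length. Bonnesen's inequality about the Steiner point finally keeps the
support function within a constant multiple of `√(L² - 4πA)` of `√(A / π)`. -/

namespace CurveFlow

open scoped Real RealInnerProductSpace

/-! ### Wirtinger's inequality -/

section Wirtinger

variable {δ w f q : ℝ → ℝ} {a b : ℝ}

lemma continuousAt_sq_mul_cos_div_sin {f' δ' u : ℝ} (hf : HasDerivAt f f' u)
    (hδ : HasDerivAt δ δ' u) (hδ' : δ' ≠ 0) (hfu : Real.sin (δ u) = 0 → f u = 0) :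
    ContinuousAt (fun v => f v ^ 2 * Real.cos (δ v) / Real.sin (δ v)) u := by
  have hcos : ContinuousAt (fun v => Real.cos (δ v)) u := hδ.cos.continuousAt
  rcases eq_or_ne (Real.sin (δ u)) 0 with hs | hs
  · have hf0 : f u = 0 := hfu hs
    have hc : Real.cos (δ u) ≠ 0 := fun h => by
      simpa [hs, h] using Real.sin_sq_add_cos_sq (δ u)
    -- Division by zero gives the value `0` at `u`, which is also the limit: near `u` the quotient
    -- `f / sin δ` is a ratio of difference quotients, hence bounded, and `f` tends to `0`.
    have hlim : Tendsto (fun v => f v * Real.cos (δ v) *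
        (slope f u v / slope (fun v => Real.sin (δ v)) u v)) (𝓝[≠] u) (𝓝 0) := by
      have h := ((hf.continuousAt.mul hcos).tendsto.mono_left nhdsWithin_le_nhds).mul
        (hf.tendsto_slope.div hδ.sin.tendsto_slope (mul_ne_zero hc hδ'))
      simpa only [Pi.mul_apply, Pi.div_apply, hf0, zero_mul] using h
    rw [continuousAt_iff_punctured_nhds]
    simp only [hs, div_zero]
    refine hlim.congr' ?_
    filter_upwards [self_mem_nhdsWithin] with v hv
    simp only [slope_def_field, hf0, hs, sub_zero]
    rw [div_div_div_cancel_right₀ (sub_ne_zero.2 hv)]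
    ring
  · exact ((hf.continuousAt.pow 2).mul hcos).div hδ.sin.continuousAt hs

lemma sub_le_integral_sq_sub_sq (hab : a ≤ b) (hδ : ∀ u, HasDerivAt δ (w u) u)
    (hw : ∀ u, 0 < w u) (hf : ∀ u, HasDerivAt f (w u * q u) u) (hwc : Continuous w)
    (hqc : Continuous q) (hsin : ∀ u ∈ Ioo a b, Real.sin (δ u) ≠ 0)
    (hzero : ∀ u ∈ Icc a b, Real.sin (δ u) = 0 → f u = 0) :
    f b ^ 2 * Real.cos (δ b) / Real.sin (δ b) - f a ^ 2 * Real.cos (δ a) / Real.sin (δ a) ≤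
      ∫ u in a..b, (q u ^ 2 - f u ^ 2) * w u := by
  have hfc : Continuous f := continuous_iff_continuousAt.2 fun u => (hf u).continuousAt
  have hderiv (u : ℝ) (hu : u ∈ Ioo a b) :
      HasDerivAt (fun v => f v ^ 2 * Real.cos (δ v) / Real.sin (δ v))
        ((q u ^ 2 - f u ^ 2) * w u -
          (q u - f u * Real.cos (δ u) / Real.sin (δ u)) ^ 2 * w u) u := by
    have hs := hsin u hu
    refine ((((hf u).pow 2).mul (hδ u).cos).div (hδ u).sin hs).congr_deriv ?_
    simp only [Pi.mul_apply, Pi.pow_apply]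
    field_simp
    push_cast
    ring
  refine intervalIntegral.sub_le_integral_of_hasDeriv_right_of_le hab
    (fun u hu => (continuousAt_sq_mul_cos_div_sin (hf u) (hδ u) (hw u).ne'
      (hzero u hu)).continuousWithinAt) (fun u hu => (hderiv u hu).hasDerivWithinAt)
    (Continuous.integrableOn_Icc (by fun_prop)) fun u _ => ?_
  exact sub_le_self _ (mul_nonneg (sq_nonneg _) (hw u).le)

lemma sin_sub_ne_zero_of_strictMono {θ : ℝ → ℝ} {c u : ℝ} (hθ : StrictMono θ)
    (hab : θ b = θ a + π) (hc : c ∈ Icc a b) (hu : u ∈ Ioo a b) (huc : u ≠ c) :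
    Real.sin (θ u - θ c) ≠ 0 := by
  have hlower : -π < θ u - θ c := by linarith [hθ hu.1, hθ.monotone hc.2]
  have hupper : θ u - θ c < π := by linarith [hθ hu.2, hθ.monotone hc.1]
  rwa [Ne, Real.sin_eq_zero_iff_of_lt_of_lt hlower hupper, sub_eq_zero, hθ.injective.eq_iff]

lemma eq_zero_of_sin_sub_eq_zero {θ : ℝ → ℝ} {c u : ℝ} (hθ : StrictMono θ)
    (hab : θ b = θ a + π) (hends : f a = f b) (hc : c ∈ Icc a b) (hfc : f c = 0)
    (hu : u ∈ Icc a b) (hs : Real.sin (θ u - θ c) = 0) : f u = 0 := by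
  rcases eq_or_ne u c with rfl | huc
  · exact hfc
  have hends_zero (hcab : c = a ∨ c = b) : f a = 0 ∧ f b = 0 := by
    rcases hcab with rfl | rfl
    exacts [⟨hfc, hends ▸ hfc⟩, ⟨hends ▸ hfc, hfc⟩]
  rcases hu.1.eq_or_lt with rfl | hau
  · refine (hends_zero (Or.inr (hc.2.eq_or_lt.resolve_right fun hcb => ?_))).1
    exact (Real.sin_neg_of_neg_of_neg_pi_lt (sub_neg.2 (hθ (hc.1.lt_of_ne huc)))
      (by linarith [hθ hcb])).ne hs
  rcases hu.2.eq_or_lt with rfl | hub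
  · refine (hends_zero (Or.inl (hc.1.eq_or_lt.resolve_right fun hac => ?_).symm)).2
    exact (Real.sin_pos_of_pos_of_lt_pi (sub_pos.2 (hθ (hc.2.lt_of_ne' huc)))
      (by linarith [hθ hac])).ne' hs
  · exact absurd hs (sin_sub_ne_zero_of_strictMono hθ hab hc ⟨hau, hub⟩ huc)

/-- **Wirtinger's inequality** in the variable `θ`, over a half period. -/
theorem integral_sq_le_integral_deriv_sq {θ : ℝ → ℝ} {c : ℝ}
    (hθ : ∀ u, HasDerivAt θ (w u) u) (hw : ∀ u, 0 < w u)
    (hf : ∀ u, HasDerivAt f (w u * q u) u) (hwc : Continuous w) (hqc : Continuous q)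
    (hab : θ b = θ a + π) (hends : f a = f b) (hc : c ∈ Icc a b) (hfc : f c = 0) :
    ∫ u in a..b, f u ^ 2 * w u ≤ ∫ u in a..b, q u ^ 2 * w u := by
  have hmono : StrictMono θ := strictMono_of_hasDerivAt_pos hθ hw
  have hfcont : Continuous f := continuous_iff_continuousAt.2 fun u => (hf u).continuousAt
  have hδ (u : ℝ) : HasDerivAt (fun v => θ v - θ c) (w u) u := (hθ u).sub_const _
  have hsin {u : ℝ} (hu : u ∈ Ioo a b) : u ≠ c → Real.sin (θ u - θ c) ≠ 0 :=
    sin_sub_ne_zero_of_strictMono hmono hab hc hu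
  have hzero {u : ℝ} (hu : u ∈ Icc a b) : Real.sin (θ u - θ c) = 0 → f u = 0 :=
    eq_zero_of_sin_sub_eq_zero hmono hab hends hc hfc hu
  have hleft := sub_le_integral_sq_sub_sq hc.1 hδ hw hf hwc hqc
    (fun u hu => hsin ⟨hu.1, hu.2.trans_le hc.2⟩ hu.2.ne)
    (fun u hu => hzero ⟨hu.1, hu.2.trans hc.2⟩)
  have hright := sub_le_integral_sq_sub_sq hc.2 hδ hw hf hwc hqc
    (fun u hu => hsin ⟨hc.1.trans_lt hu.1, hu.2⟩ hu.1.ne')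
    (fun u hu => hzero ⟨hc.1.trans hu.1, hu.2⟩)
  have hends' : f a ^ 2 * Real.cos (θ a - θ c) / Real.sin (θ a - θ c) =
      f b ^ 2 * Real.cos (θ b - θ c) / Real.sin (θ b - θ c) := by
    rw [hab, hends, add_sub_right_comm, Real.sin_add_pi, Real.cos_add_pi, mul_neg, neg_div_neg_eq]
  have hint (s t : ℝ) : IntervalIntegrable (fun u => (q u ^ 2 - f u ^ 2) * w u) volume s t :=
    Continuous.intervalIntegrable (by fun_prop) _ _
  have hadd := intervalIntegral.integral_add_adjacent_intervals (hint a c) (hint c b)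
  rw [← sub_nonneg, ← intervalIntegral.integral_sub
    (Continuous.intervalIntegrable (by fun_prop) _ _)
    (Continuous.intervalIntegrable (by fun_prop) _ _)]
  simp only [← sub_mul]
  linarith

end Wirtinger

/-! ### Regular closed curves -/

section Rotation

variable {v w : Plane}

lemma inner_eq_add (v w : Plane) : ⟪v, w⟫ = v 0 * w 0 + v 1 * w 1 := by
  simp only [PiLp.inner_apply, Fin.sum_univ_two, RCLike.inner_apply, conj_trivial]
  ring

lemma inner_rot_left (v w : Plane) : ⟪rot v, w⟫ = -⟪v, rot w⟫ := by
  simp [inner_eq_add, rot]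

lemma inner_rot_rot (v w : Plane) : ⟪rot v, rot w⟫ = ⟪v, w⟫ := by
  simp [inner_eq_add, rot, add_comm]

lemma inner_rot_self (v : Plane) : ⟪rot v, v⟫ = 0 := by
  simp [inner_eq_add, rot, mul_comm]

lemma inner_self_rot (v : Plane) : ⟪v, rot v⟫ = 0 := by
  rw [real_inner_comm, inner_rot_self]

lemma rot_rot (v : Plane) : rot (rot v) = -v := by
  ext i
  fin_cases i <;> simp [rot]

lemma norm_rot (v : Plane) : ‖rot v‖ = ‖v‖ := by
  rw [norm_eq_sqrt_real_inner, inner_rot_rot, ← norm_eq_sqrt_real_inner]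

/-- The rotation `rot` as a linear isometry. -/
def rotIsometry : Plane →ₗᵢ[ℝ] Plane where
  toFun := rot
  map_add' v w := by ext i; fin_cases i <;> simp [rot, add_comm]
  map_smul' c v := by ext i; fin_cases i <;> simp [rot]
  norm_map' := norm_rot

lemma rotIsometry_apply (v : Plane) : rotIsometry v = rot v := rfl

lemma rot_smul (c : ℝ) (v : Plane) : rot (c • v) = c • rot v := rotIsometry.map_smul c v

lemma rot_neg (v : Plane) : rot (-v) = -rot v := rotIsometry.map_neg v

lemma hasDerivAt_rot {f : ℝ → Plane} {f' : Plane} {u : ℝ} (hf : HasDerivAt f f' u) :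
    HasDerivAt (fun v => rot (f v)) (rot f') u :=
  rotIsometry.toContinuousLinearMap.hasFDerivAt.comp_hasDerivAt u hf

lemma continuous_rot : Continuous rot := rotIsometry.continuous

lemma inner_smul_add_inner_rot_smul (hv : ‖v‖ = 1) (w : Plane) :
    ⟪v, w⟫ • v + ⟪rot v, w⟫ • rot v = w := by
  have h : v 0 * v 0 + v 1 * v 1 = 1 := by
    rw [← inner_eq_add, real_inner_self_eq_norm_sq, hv, one_pow]
  ext i
  fin_cases i
  all_goals
    simp only [inner_eq_add, rot, PiLp.add_apply, PiLp.smul_apply, smul_eq_mul, Fin.zero_eta,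
      Fin.mk_one, Matrix.cons_val_zero, Matrix.cons_val_one]
  · linear_combination w 0 * h
  · linear_combination w 1 * h

lemma norm_sq_eq_inner_sq_add_inner_rot_sq (hv : ‖v‖ = 1) (w : Plane) :
    ‖w‖ ^ 2 = ⟪v, w⟫ ^ 2 + ⟪rot v, w⟫ ^ 2 := by
  nth_rw 1 [← real_inner_self_eq_norm_sq, ← inner_smul_add_inner_rot_smul hv w]
  rw [inner_add_left, real_inner_smul_left, real_inner_smul_left]
  ring

lemma exists_cos_smul_add_sin_smul_rot (hv : ‖v‖ = 1) (hw : ‖w‖ = 1) :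
    ∃ θ : ℝ, w = Real.cos θ • v + Real.sin θ • rot v := by
  have hsq : ⟪v, w⟫ ^ 2 + ⟪rot v, w⟫ ^ 2 = 1 := by
    rw [← norm_sq_eq_inner_sq_add_inner_rot_sq hv, hw, one_pow]
  have hnorm : ‖(⟨⟪v, w⟫, ⟪rot v, w⟫⟩ : ℂ)‖ = 1 := by
    rw [← sq_eq_sq₀ (norm_nonneg _) zero_le_one, Complex.sq_norm, Complex.normSq_mk]
    linarith
  refine ⟨Complex.arg ⟨⟪v, w⟫, ⟪rot v, w⟫⟩, ?_⟩
  rw [Complex.cos_arg (norm_ne_zero_iff.1 (hnorm ▸ one_ne_zero)), Complex.sin_arg, hnorm, div_one,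
    div_one, inner_smul_add_inner_rot_smul hv]

end Rotation

lemma periodic_deriv {E : Type*} [NormedAddCommGroup E] [NormedSpace ℝ E] {f : ℝ → E} {p : ℝ}
    (hf : Function.Periodic f p) : Function.Periodic (deriv f) p := fun u => by
  rw [← deriv_comp_add_const, hf.funext]

/-- A smooth regular closed curve, parametrized by `ℝ / 2πℤ`; self-intersections are allowed. -/
structure IsRegularLoop (γ : ℝ → Plane) : Prop where
  smooth : ContDiff ℝ ∞ γ
  periodic : Function.Periodic γ (2 * π)
  regular : ∀ u, deriv γ u ≠ 0

/-- The derivative `κ g` of the direction angle of the tangent with respect to the parameter. -/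
noncomputable def turningRate (γ : ℝ → Plane) (u : ℝ) : ℝ := curvature γ u * metric γ u

namespace IsRegularLoop

variable {γ : ℝ → Plane}

lemma metric_pos (hγ : IsRegularLoop γ) (u : ℝ) : 0 < metric γ u := norm_pos_iff.2 (hγ.regular u)

lemma contDiff_deriv (hγ : IsRegularLoop γ) : ContDiff ℝ ∞ (deriv γ) :=
  (contDiff_infty_iff_deriv.1 hγ.smooth).2

lemma contDiff_metric (hγ : IsRegularLoop γ) : ContDiff ℝ ∞ (metric γ) :=
  hγ.contDiff_deriv.norm ℝ hγ.regular

lemma contDiff_tangent (hγ : IsRegularLoop γ) : ContDiff ℝ ∞ (tangent γ) :=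
  (hγ.contDiff_metric.inv fun u => (hγ.metric_pos u).ne').smul hγ.contDiff_deriv

lemma continuous (hγ : IsRegularLoop γ) : Continuous γ := hγ.smooth.continuous

lemma continuous_metric (hγ : IsRegularLoop γ) : Continuous (metric γ) :=
  hγ.contDiff_metric.continuous

lemma continuous_tangent (hγ : IsRegularLoop γ) : Continuous (tangent γ) :=
  hγ.contDiff_tangent.continuous

lemma continuous_normal (hγ : IsRegularLoop γ) : Continuous (normal γ) :=
  continuous_rot.comp hγ.continuous_tangent

lemma continuous_curvature (hγ : IsRegularLoop γ) : Continuous (curvature γ) :=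
  ((hγ.continuous_metric.inv₀ fun u => (hγ.metric_pos u).ne').smul
    (contDiff_infty_iff_deriv.1 hγ.contDiff_tangent).2.continuous).inner hγ.continuous_normal

lemma continuous_turningRate (hγ : IsRegularLoop γ) : Continuous (turningRate γ) :=
  hγ.continuous_curvature.mul hγ.continuous_metric

lemma norm_tangent (hγ : IsRegularLoop γ) (u : ℝ) : ‖tangent γ u‖ = 1 :=
  norm_smul_inv_norm (𝕜 := ℝ) (hγ.regular u)

lemma norm_normal (hγ : IsRegularLoop γ) (u : ℝ) : ‖normal γ u‖ = 1 := by
  rw [normal, norm_rot, hγ.norm_tangent]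

lemma inner_tangent_tangent (hγ : IsRegularLoop γ) (u : ℝ) : ⟪tangent γ u, tangent γ u⟫ = 1 := by
  rw [real_inner_self_eq_norm_sq, hγ.norm_tangent, one_pow]

lemma inner_normal_normal (hγ : IsRegularLoop γ) (u : ℝ) : ⟪normal γ u, normal γ u⟫ = 1 := by
  rw [real_inner_self_eq_norm_sq, hγ.norm_normal, one_pow]

lemma metric_smul_tangent (hγ : IsRegularLoop γ) (u : ℝ) :
    metric γ u • tangent γ u = deriv γ u :=
  smul_inv_smul₀ (hγ.metric_pos u).ne' _

lemma hasDerivAt (hγ : IsRegularLoop γ) (u : ℝ) :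
    HasDerivAt γ (metric γ u • tangent γ u) u :=
  hγ.metric_smul_tangent u ▸ (hγ.smooth.differentiable (by simp) u).hasDerivAt

lemma inner_deriv_tangent_normal (hγ : IsRegularLoop γ) (u : ℝ) :
    ⟪deriv (tangent γ) u, normal γ u⟫ = turningRate γ u := by
  rw [turningRate, curvature, real_inner_smul_left]
  field_simp [(hγ.metric_pos u).ne']

lemma hasDerivAt_tangent (hγ : IsRegularLoop γ) (u : ℝ) :
    HasDerivAt (tangent γ) (turningRate γ u • normal γ u) u := by
  have hderiv : HasDerivAt (tangent γ) (deriv (tangent γ) u) u :=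
    (hγ.contDiff_tangent.differentiable (by simp) u).hasDerivAt
  have horth : ⟪tangent γ u, deriv (tangent γ) u⟫ = 0 := by
    have h := (hderiv.inner ℝ hderiv).unique
      ((hasDerivAt_const u (1 : ℝ)).congr_of_eventuallyEq
        (Eventually.of_forall hγ.inner_tangent_tangent))
    rw [real_inner_comm (tangent γ u)] at h
    linarith
  refine hderiv.congr_deriv ?_
  rw [← inner_smul_add_inner_rot_smul (hγ.norm_tangent u) (deriv (tangent γ) u), horth, zero_smul,
    zero_add, real_inner_comm, ← hγ.inner_deriv_tangent_normal]
  rfl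

lemma hasDerivAt_normal (hγ : IsRegularLoop γ) (u : ℝ) :
    HasDerivAt (normal γ) (-(turningRate γ u • tangent γ u)) u := by
  refine (hasDerivAt_rot (hγ.hasDerivAt_tangent u)).congr_deriv ?_
  rw [rot_smul, normal, rot_rot, smul_neg]

lemma periodic_metric (hγ : IsRegularLoop γ) : Function.Periodic (metric γ) (2 * π) :=
  (periodic_deriv hγ.periodic).comp norm

lemma periodic_tangent (hγ : IsRegularLoop γ) : Function.Periodic (tangent γ) (2 * π) := fun u => by
  rw [tangent, tangent, hγ.periodic_metric, periodic_deriv hγ.periodic]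

lemma periodic_normal (hγ : IsRegularLoop γ) : Function.Periodic (normal γ) (2 * π) :=
  hγ.periodic_tangent.comp rot

lemma periodic_curvature (hγ : IsRegularLoop γ) : Function.Periodic (curvature γ) (2 * π) :=
  fun u => by
    rw [curvature, curvature, hγ.periodic_metric, hγ.periodic_normal,
      periodic_deriv hγ.periodic_tangent]

lemma periodic_turningRate (hγ : IsRegularLoop γ) : Function.Periodic (turningRate γ) (2 * π) :=
  hγ.periodic_curvature.mul hγ.periodic_metric

end IsRegularLoop

/-! ### Support function and direction angle -/

/-- The support function of `γ` with respect to the point `c`: the signed distance of `c` from the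
tangent line at parameter `u`, positive on the left of that line. -/
noncomputable def support (γ : ℝ → Plane) (c : Plane) (u : ℝ) : ℝ := ⟪c - γ u, normal γ u⟫

/-- The tangential component of the position of `γ` relative to the point `c`. -/
noncomputable def tangential (γ : ℝ → Plane) (c : Plane) (u : ℝ) : ℝ := ⟪γ u - c, tangent γ u⟫

/-- The direction angle of the tangent, normalized to vanish at the parameter `0`. -/
noncomputable def angle (γ : ℝ → Plane) (u : ℝ) : ℝ := ∫ v in (0 : ℝ)..u, turningRate γ v

/-- A regular closed curve of positive curvature whose tangent makes exactly one turn, i.e. a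
strictly convex counterclockwise curve. -/
structure IsConvexLoop (γ : ℝ → Plane) : Prop extends IsRegularLoop γ where
  curvature_pos : ∀ u, 0 < curvature γ u
  integral_turningRate : ∫ u in (0 : ℝ)..2 * π, turningRate γ u = 2 * π

lemma area_eq_integral_inner_rot (γ : ℝ → Plane) :
    area γ = 1 / 2 * ∫ u in (0 : ℝ)..2 * π, ⟪rot (γ u), deriv γ u⟫ := by
  rw [area]
  congr 2 with u
  rw [inner_eq_add]
  simp only [rot, PiLp.toLp_apply, Matrix.cons_val_zero, Matrix.cons_val_one]
  ring

namespace IsRegularLoop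

variable {γ : ℝ → Plane}

lemma continuous_support (hγ : IsRegularLoop γ) (c : Plane) : Continuous (support γ c) :=
  (continuous_const.sub hγ.continuous).inner hγ.continuous_normal

lemma continuous_tangential (hγ : IsRegularLoop γ) (c : Plane) : Continuous (tangential γ c) :=
  (hγ.continuous.sub continuous_const).inner hγ.continuous_tangent

lemma periodic_support (hγ : IsRegularLoop γ) (c : Plane) :
    Function.Periodic (support γ c) (2 * π) := fun u => by
  rw [support, support, hγ.periodic, hγ.periodic_normal]

lemma periodic_tangential (hγ : IsRegularLoop γ) (c : Plane) :
    Function.Periodic (tangential γ c) (2 * π) := fun u => by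
  rw [tangential, tangential, hγ.periodic, hγ.periodic_tangent]

lemma hasDerivAt_support (hγ : IsRegularLoop γ) (c : Plane) (u : ℝ) :
    HasDerivAt (support γ c) (turningRate γ u * tangential γ c u) u := by
  refine (((hγ.hasDerivAt u).const_sub c).inner ℝ (hγ.hasDerivAt_normal u)).congr_deriv ?_
  rw [tangential, ← neg_sub (γ u) c, inner_neg_neg, real_inner_smul_right, inner_neg_left,
    real_inner_smul_left, normal, inner_self_rot, mul_zero, neg_zero, add_zero]

lemma hasDerivAt_tangential (hγ : IsRegularLoop γ) (c : Plane) (u : ℝ) :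
    HasDerivAt (tangential γ c) (metric γ u - turningRate γ u * support γ c u) u := by
  refine (((hγ.hasDerivAt u).sub_const c).inner ℝ (hγ.hasDerivAt_tangent u)).congr_deriv ?_
  rw [support, ← neg_sub (γ u) c, inner_neg_left, real_inner_smul_right, real_inner_smul_left,
    hγ.inner_tangent_tangent]
  ring

lemma hasDerivAt_angle (hγ : IsRegularLoop γ) (u : ℝ) :
    HasDerivAt (angle γ) (turningRate γ u) u :=
  (hγ.continuous_turningRate.integral_hasStrictDerivAt 0 u).hasDerivAt

lemma continuous_angle (hγ : IsRegularLoop γ) : Continuous (angle γ) :=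
  continuous_iff_continuousAt.2 fun u => (hγ.hasDerivAt_angle u).continuousAt

lemma integral_turningRate_eq_angle_sub (hγ : IsRegularLoop γ) (a b : ℝ) :
    ∫ u in a..b, turningRate γ u = angle γ b - angle γ a :=
  intervalIntegral.integral_eq_sub_of_hasDerivAt (fun u _ => hγ.hasDerivAt_angle u)
    (hγ.continuous_turningRate.intervalIntegrable _ _)

lemma tangent_eq_cos_angle_smul_add (hγ : IsRegularLoop γ) (u : ℝ) :
    tangent γ u = Real.cos (angle γ u) • tangent γ 0 + Real.sin (angle γ u) • normal γ 0 := by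
  -- Turning the tangent back by its direction angle gives a constant vector.
  have hconst : Real.cos (angle γ u) • tangent γ u - Real.sin (angle γ u) • normal γ u =
      tangent γ 0 := by
    have hderiv (v : ℝ) : HasDerivAt (fun v => Real.cos (angle γ v) • tangent γ v -
        Real.sin (angle γ v) • normal γ v) 0 v := by
      refine (((hγ.hasDerivAt_angle v).cos.smul (hγ.hasDerivAt_tangent v)).sub
        ((hγ.hasDerivAt_angle v).sin.smul (hγ.hasDerivAt_normal v))).congr_deriv ?_
      module
    have h := is_const_of_deriv_eq_zero (fun v => (hderiv v).differentiableAt)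
      (fun v => (hderiv v).deriv) u 0
    simpa [angle] using h
  have hnormal : normal γ 0 =
      Real.cos (angle γ u) • normal γ u + Real.sin (angle γ u) • tangent γ u := by
    rw [normal, ← hconst, ← rotIsometry_apply, map_sub, map_smul, map_smul, rotIsometry_apply,
      rotIsometry_apply, normal, rot_rot]
    module
  rw [← hconst, hnormal]
  linear_combination (norm := module) (-(Real.sin_sq_add_cos_sq (angle γ u))) • tangent γ u

lemma tangent_eq_neg_of_angle_eq_add_pi (hγ : IsRegularLoop γ) {u v : ℝ}
    (h : angle γ v = angle γ u + π) : tangent γ v = -tangent γ u := by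
  rw [hγ.tangent_eq_cos_angle_smul_add v, hγ.tangent_eq_cos_angle_smul_add u, h, Real.cos_add_pi,
    Real.sin_add_pi]
  module

lemma sub_eq_tangential_smul_sub_support_smul (hγ : IsRegularLoop γ) (c : Plane) (u : ℝ) :
    γ u - c = tangential γ c u • tangent γ u - support γ c u • normal γ u := by
  nth_rw 1 [← inner_smul_add_inner_rot_smul (hγ.norm_tangent u) (γ u - c)]
  rw [tangential, support, real_inner_comm, ← neg_sub (γ u) c, inner_neg_left, neg_smul,
    sub_neg_eq_add, real_inner_comm (normal γ u), normal]

lemma integral_support_mul_turningRate (hγ : IsRegularLoop γ) {c : Plane} {a b : ℝ}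
    (h : tangential γ c a = tangential γ c b) :
    ∫ u in a..b, support γ c u * turningRate γ u = ∫ u in a..b, metric γ u := by
  have hg := hγ.continuous_metric
  have hw := hγ.continuous_turningRate
  have hs := hγ.continuous_support c
  have key := intervalIntegral.integral_eq_sub_of_hasDerivAt
    (fun u (_ : u ∈ uIcc a b) => hγ.hasDerivAt_tangential c u)
    (Continuous.intervalIntegrable (by fun_prop) _ _)
  rw [← h, sub_self, intervalIntegral.integral_sub (hg.intervalIntegrable _ _)
    (Continuous.intervalIntegrable (by fun_prop) _ _)] at key
  simp only [mul_comm (support γ c _)]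
  linarith

lemma integral_support_mul_metric_eq (hγ : IsRegularLoop γ) (c : Plane) (a b : ℝ) :
    ∫ u in a..b, support γ c u * metric γ u =
      (∫ u in a..b, support γ 0 u * metric γ u) + ⟪c, rot (γ b) - rot (γ a)⟫ := by
  have hderiv (u : ℝ) : HasDerivAt (fun v => ⟪c, rot (γ v)⟫)
      (support γ c u * metric γ u - support γ 0 u * metric γ u) u := by
    refine ((hasDerivAt_const u c).inner ℝ (hasDerivAt_rot (hγ.hasDerivAt u))).congr_deriv ?_
    rw [support, support, inner_sub_left, inner_sub_left, rot_smul, real_inner_smul_right, normal]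
    simp only [inner_zero_left]
    ring
  have hg := hγ.continuous_metric
  have hc := hγ.continuous_support c
  have h0 := hγ.continuous_support 0
  rw [inner_sub_right, ← intervalIntegral.integral_eq_sub_of_hasDerivAt (fun u _ => hderiv u)
    (Continuous.intervalIntegrable (by fun_prop) _ _), intervalIntegral.integral_sub
    (Continuous.intervalIntegrable (by fun_prop) _ _)
    (Continuous.intervalIntegrable (by fun_prop) _ _), add_sub_cancel]

lemma continuous_integral_support_midpoint (hγ : IsRegularLoop γ) {o : ℝ → ℝ}
    (ho : Continuous o) :
    Continuous fun u => ∫ v in u..o u, support γ (midpoint ℝ (γ u) (γ (o u))) v * metric γ v := by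
  have hγc := hγ.continuous
  have hrot := continuous_rot
  have hint (a b : ℝ) : IntervalIntegrable (fun v => support γ 0 v * metric γ v) volume a b :=
    ((hγ.continuous_support 0).mul hγ.continuous_metric).intervalIntegrable _ _
  have hprim := intervalIntegral.continuous_primitive hint 0
  have hsplit (u : ℝ) :
      ∫ v in u..o u, support γ (midpoint ℝ (γ u) (γ (o u))) v * metric γ v =
        (∫ v in (0 : ℝ)..o u, support γ 0 v * metric γ v) -
          (∫ v in (0 : ℝ)..u, support γ 0 v * metric γ v) +
          ⟪midpoint ℝ (γ u) (γ (o u)), rot (γ (o u)) - rot (γ u)⟫ := by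
    rw [intervalIntegral.integral_interval_sub_left (hint _ _) (hint _ _),
      ← hγ.integral_support_mul_metric_eq]
  simp only [hsplit]
  simp only [midpoint_eq_smul_add]
  fun_prop

lemma area_eq_integral_support (hγ : IsRegularLoop γ) (c : Plane) :
    area γ = 1 / 2 * ∫ u in (0 : ℝ)..2 * π, support γ c u * metric γ u := by
  have hclosed : γ (2 * π) = γ 0 := by simpa using hγ.periodic 0
  rw [hγ.integral_support_mul_metric_eq c, hclosed, sub_self, inner_zero_right, add_zero,
    area_eq_integral_inner_rot]
  congr 2 with u
  rw [← hγ.metric_smul_tangent u, real_inner_smul_right, inner_rot_left, support, zero_sub,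
    inner_neg_left, normal, mul_comm]

end IsRegularLoop

namespace IsConvexLoop

variable {γ : ℝ → Plane}

lemma turningRate_pos (hγ : IsConvexLoop γ) (u : ℝ) : 0 < turningRate γ u :=
  mul_pos (hγ.curvature_pos u) (hγ.metric_pos u)

lemma strictMono_angle (hγ : IsConvexLoop γ) : StrictMono (angle γ) :=
  strictMono_of_hasDerivAt_pos hγ.hasDerivAt_angle hγ.turningRate_pos

lemma angle_add_two_pi (hγ : IsConvexLoop γ) (u : ℝ) : angle γ (u + 2 * π) = angle γ u + 2 * π := by
  have h := hγ.periodic_turningRate.intervalIntegral_add_eq u 0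
  rw [zero_add, hγ.integral_turningRate, hγ.integral_turningRate_eq_angle_sub] at h
  linarith

lemma surjective_angle (hγ : IsConvexLoop γ) : Function.Surjective (angle γ) :=
  hγ.continuous_angle.surjective
    (hγ.periodic_turningRate.tendsto_atTop_intervalIntegral_of_pos'
      (hγ.continuous_turningRate.intervalIntegrable _ _) hγ.turningRate_pos Real.two_pi_pos)
    (hγ.periodic_turningRate.tendsto_atBot_intervalIntegral_of_pos'
      (hγ.continuous_turningRate.intervalIntegrable _ _) hγ.turningRate_pos Real.two_pi_pos)

end IsConvexLoop

/-! ### Half turns -/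

/-- The arc of `γ` from parameter `a` to parameter `b` makes half a turn, and its end points are
symmetric about `c`. -/
structure IsHalfTurn (γ : ℝ → Plane) (c : Plane) (a b : ℝ) : Prop where
  angle_eq : angle γ b = angle γ a + π
  midpoint_eq : midpoint ℝ (γ a) (γ b) = c

namespace IsHalfTurn

variable {γ : ℝ → Plane} {c : Plane} {a b : ℝ}

lemma lt (h : IsHalfTurn γ c a b) (hγ : IsConvexLoop γ) : a < b :=
  hγ.strictMono_angle.lt_iff_lt.1 (by linarith [h.angle_eq, Real.pi_pos])

lemma integral_turningRate (h : IsHalfTurn γ c a b) (hγ : IsRegularLoop γ) :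
    ∫ u in a..b, turningRate γ u = π := by
  rw [hγ.integral_turningRate_eq_angle_sub, h.angle_eq, add_sub_cancel_left]

lemma tangent_eq_neg (h : IsHalfTurn γ c a b) (hγ : IsRegularLoop γ) :
    tangent γ b = -tangent γ a :=
  hγ.tangent_eq_neg_of_angle_eq_add_pi h.angle_eq

lemma sub_eq_sub (h : IsHalfTurn γ c a b) : c - γ b = γ a - c := by
  rw [← h.midpoint_eq, midpoint_sub_right, left_sub_midpoint]

lemma support_eq (h : IsHalfTurn γ c a b) (hγ : IsRegularLoop γ) :
    support γ c a = support γ c b := by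
  rw [support, support, normal, normal, h.tangent_eq_neg hγ, h.sub_eq_sub, rot_neg,
    ← neg_sub c (γ a), inner_neg_neg]

lemma tangential_eq (h : IsHalfTurn γ c a b) (hγ : IsRegularLoop γ) :
    tangential γ c a = tangential γ c b := by
  rw [tangential, tangential, h.tangent_eq_neg hγ, ← h.sub_eq_sub, ← neg_sub (γ b) c,
    inner_neg_left, inner_neg_right]

lemma integral_support_mul_turningRate (h : IsHalfTurn γ c a b) (hγ : IsRegularLoop γ) :
    ∫ u in a..b, support γ c u * turningRate γ u = ∫ u in a..b, metric γ u :=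
  hγ.integral_support_mul_turningRate (h.tangential_eq hγ)

lemma integral_tangential_sq_mul_turningRate (h : IsHalfTurn γ c a b) (hγ : IsRegularLoop γ) :
    ∫ u in a..b, tangential γ c u ^ 2 * turningRate γ u =
      (∫ u in a..b, support γ c u ^ 2 * turningRate γ u) -
        ∫ u in a..b, support γ c u * metric γ u := by
  have hg := hγ.continuous_metric
  have hw := hγ.continuous_turningRate
  have hs := hγ.continuous_support c
  have hq := hγ.continuous_tangential c
  have hderiv (u : ℝ) : HasDerivAt (fun v => support γ c v * tangential γ c v)
      (tangential γ c u ^ 2 * turningRate γ u + support γ c u * metric γ u -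
        support γ c u ^ 2 * turningRate γ u) u :=
    ((hγ.hasDerivAt_support c u).mul (hγ.hasDerivAt_tangential c u)).congr_deriv (by ring)
  have key := intervalIntegral.integral_eq_sub_of_hasDerivAt (fun u (_ : u ∈ uIcc a b) => hderiv u)
    (Continuous.intervalIntegrable (by fun_prop) _ _)
  simp (disch := exact Continuous.intervalIntegrable (by fun_prop) _ _) only
    [intervalIntegral.integral_sub, intervalIntegral.integral_add, ← h.support_eq hγ,
      ← h.tangential_eq hγ, sub_self] at key
  linarith

/-- Bonnesen's inequality for a half turn: Wirtinger's inequality for `support γ c - support γ c u`,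
whose angular derivative is the tangential component. -/
theorem bonnesen (h : IsHalfTurn γ c a b) (hγ : IsConvexLoop γ) {u : ℝ} (hu : u ∈ Icc a b) :
    (∫ v in a..b, support γ c v * metric γ v) - 2 * support γ c u * (∫ v in a..b, metric γ v) +
      π * support γ c u ^ 2 ≤ 0 := by
  have hw := hγ.continuous_turningRate
  have hs := hγ.continuous_support c
  have hwirtinger := integral_sq_le_integral_deriv_sq
    (f := fun v => support γ c v - support γ c u) hγ.hasDerivAt_angle hγ.turningRate_pos
    (fun v => (hγ.hasDerivAt_support c v).sub_const _) hw (hγ.continuous_tangential c) h.angle_eq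
    (by simp only [h.support_eq hγ.toIsRegularLoop]) hu (sub_self _)
  have hexpand (v : ℝ) : (support γ c v - support γ c u) ^ 2 * turningRate γ v =
      support γ c v ^ 2 * turningRate γ v - 2 * support γ c u * (support γ c v * turningRate γ v) +
        support γ c u ^ 2 * turningRate γ v := by ring
  simp (disch := exact Continuous.intervalIntegrable (by fun_prop) _ _) only
    [hexpand, intervalIntegral.integral_sub, intervalIntegral.integral_add,
      intervalIntegral.integral_const_mul, h.integral_support_mul_turningRate hγ.toIsRegularLoop,
      h.integral_tangential_sq_mul_turningRate hγ.toIsRegularLoop,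
      h.integral_turningRate hγ.toIsRegularLoop] at hwirtinger
  linarith

lemma integral_bonnesen (h : IsHalfTurn γ c a b) (hγ : IsConvexLoop γ) {ρ : ℝ → ℝ}
    (hρ : Continuous ρ) (hρ0 : ∀ u, 0 ≤ ρ u) :
    π * ∫ u in a..b, support γ c u ^ 2 * ρ u ≤
      2 * (∫ u in a..b, metric γ u) * (∫ u in a..b, support γ c u * ρ u) -
        (∫ u in a..b, support γ c u * metric γ u) * ∫ u in a..b, ρ u := by
  have hs := hγ.continuous_support c
  set S := ∫ u in a..b, support γ c u * metric γ u
  set l := ∫ u in a..b, metric γ u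
  have hnonneg : 0 ≤ ∫ u in a..b, (2 * l * (support γ c u * ρ u) - S * ρ u -
      π * (support γ c u ^ 2 * ρ u)) := by
    refine intervalIntegral.integral_nonneg (h.lt hγ).le fun u hu => ?_
    linarith [mul_nonpos_of_nonpos_of_nonneg (h.bonnesen hγ hu) (hρ0 u)]
  simp (disch := exact Continuous.intervalIntegrable (by fun_prop) _ _) only
    [intervalIntegral.integral_sub, intervalIntegral.integral_const_mul] at hnonneg
  linarith

lemma pi_mul_integral_support_mul_metric_le_sq (h : IsHalfTurn γ c a b) (hγ : IsConvexLoop γ) :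
    π * (∫ u in a..b, support γ c u * metric γ u) ≤ (∫ u in a..b, metric γ u) ^ 2 := by
  have hbonnesen := h.bonnesen hγ (left_mem_Icc.2 (h.lt hγ).le)
  nlinarith [sq_nonneg (π * support γ c a - ∫ u in a..b, metric γ u), Real.pi_pos]

theorem pi_mul_integral_support_sq_mul_metric_le (h : IsHalfTurn γ c a b) (hγ : IsConvexLoop γ) :
    π * ∫ u in a..b, support γ c u ^ 2 * metric γ u ≤
      (∫ u in a..b, support γ c u * metric γ u) * ∫ u in a..b, metric γ u := by
  linarith [h.integral_bonnesen hγ hγ.continuous_metric fun u => (hγ.metric_pos u).le]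

lemma integral_support_sq_mul_turningRate_le (h : IsHalfTurn γ c a b) (hγ : IsConvexLoop γ) :
    ∫ u in a..b, support γ c u ^ 2 * turningRate γ u ≤
      2 * (∫ u in a..b, metric γ u) ^ 2 / π - ∫ u in a..b, support γ c u * metric γ u := by
  have key := h.integral_bonnesen hγ hγ.continuous_turningRate fun u => (hγ.turningRate_pos u).le
  rw [h.integral_turningRate hγ.toIsRegularLoop,
    h.integral_support_mul_turningRate hγ.toIsRegularLoop] at key
  rw [← sub_nonneg] at key ⊢
  refine nonneg_of_mul_nonneg_right (key.trans_eq ?_) Real.pi_pos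
  field_simp

theorem le_integral_inv_curvature (h : IsHalfTurn γ c a b) (hγ : IsConvexLoop γ) :
    2 * (∫ u in a..b, metric γ u) ^ 2 / π - (∫ u in a..b, support γ c u * metric γ u) ≤
      ∫ u in a..b, 1 / curvature γ u * metric γ u := by
  have hg := hγ.continuous_metric
  have hw := hγ.continuous_turningRate
  have hs := hγ.continuous_support c
  have hκ : Continuous fun u => 1 / curvature γ u :=
    continuous_const.div hγ.continuous_curvature fun u => (hγ.curvature_pos u).ne'
  set l := ∫ u in a..b, metric γ u with hl
  -- `2 * l / π` is the mean of `1 / κ + support γ c` with respect to the direction angle.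
  have hsq : 0 ≤ ∫ u in a..b, (1 / curvature γ u + support γ c u - 2 * l / π) ^ 2 *
      turningRate γ u :=
    intervalIntegral.integral_nonneg (h.lt hγ).le fun u _ =>
      mul_nonneg (sq_nonneg _) (hγ.turningRate_pos u).le
  have hexpand (u : ℝ) : (1 / curvature γ u + support γ c u - 2 * l / π) ^ 2 * turningRate γ u =
      1 / curvature γ u * metric γ u + 2 * (support γ c u * metric γ u) -
        2 * (2 * l / π) * metric γ u + support γ c u ^ 2 * turningRate γ u -
        2 * (2 * l / π) * (support γ c u * turningRate γ u) +
        (2 * l / π) ^ 2 * turningRate γ u := by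
    rw [turningRate]
    field_simp [(hγ.curvature_pos u).ne']
    ring
  simp (disch := exact Continuous.intervalIntegrable (by fun_prop) _ _) only
    [hexpand, intervalIntegral.integral_sub, intervalIntegral.integral_add,
      intervalIntegral.integral_const_mul, h.integral_support_mul_turningRate hγ.toIsRegularLoop,
      h.integral_turningRate hγ.toIsRegularLoop, ← hl] at hsq
  have hsupport := h.integral_support_sq_mul_turningRate_le hγ
  have hcancel : (2 * l / π) ^ 2 * π = 2 * (2 * l / π) * l := by
    field_simp
  have hlin : 2 * l ^ 2 / π = 2 * l / π * l := by ring
  linarith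

end IsHalfTurn

namespace IsConvexLoop

variable {γ : ℝ → Plane}

lemma integral_support_mul_metric_add_two_pi (hγ : IsConvexLoop γ) (c : Plane) (a : ℝ) :
    ∫ u in a..a + 2 * π, support γ c u * metric γ u = 2 * area γ := by
  have h := ((hγ.periodic_support c).mul hγ.periodic_metric).intervalIntegral_add_eq a 0
  simp only [Pi.mul_apply, zero_add] at h
  rw [h, hγ.area_eq_integral_support c]
  ring

lemma exists_continuous_angle_eq_add_pi (hγ : IsConvexLoop γ) :
    ∃ o : ℝ → ℝ, Continuous o ∧ ∀ u, angle γ (o u) = angle γ u + π := by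
  let e := hγ.strictMono_angle.orderIsoOfSurjective _ hγ.surjective_angle
  exact ⟨fun u => e.symm (angle γ u + π),
    e.symm.continuous.comp (hγ.continuous_angle.add continuous_const),
    fun u => e.apply_symm_apply _⟩

theorem exists_bisecting_isHalfTurn (hγ : IsConvexLoop γ) :
    ∃ c a b, IsHalfTurn γ c a b ∧ IsHalfTurn γ c b (a + 2 * π) ∧
      ∫ u in a..b, support γ c u * metric γ u = area γ ∧
      ∫ u in b..a + 2 * π, support γ c u * metric γ u = area γ := by
  obtain ⟨o, ho, hangle⟩ := hγ.exists_continuous_angle_eq_add_pi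
  have hoo (u : ℝ) : o (o u) = u + 2 * π := hγ.strictMono_angle.injective <| by
    rw [hangle, hangle, hγ.angle_add_two_pi]
    ring
  have hint (c : Plane) (a b : ℝ) :
      IntervalIntegrable (fun u => support γ c u * metric γ u) volume a b :=
    ((hγ.continuous_support c).mul hγ.continuous_metric).intervalIntegrable _ _
  set m : ℝ → Plane := fun u => midpoint ℝ (γ u) (γ (o u)) with hm
  have hmo (u : ℝ) : m (o u) = m u := by
    simp only [hm, hoo, hγ.periodic u, midpoint_comm]
  set Φ : ℝ → ℝ := fun u => ∫ v in u..o u, support γ (m u) v * metric γ v with hΦ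
  have hsum (u : ℝ) : Φ u + Φ (o u) = 2 * area γ := by
    simp only [hΦ, hmo, hoo]
    rw [intervalIntegral.integral_add_adjacent_intervals (hint _ _ _) (hint _ _ _),
      hγ.integral_support_mul_metric_add_two_pi]
  have hcont : Continuous Φ := hγ.continuous_integral_support_midpoint ho
  obtain ⟨a, ha⟩ : area γ ∈ range Φ := by
    rcases le_total (Φ 0) (area γ) with h | h
    · exact mem_range_of_exists_le_of_exists_ge hcont ⟨0, h⟩ ⟨o 0, by linarith [hsum 0]⟩
    · exact mem_range_of_exists_le_of_exists_ge hcont ⟨o 0, by linarith [hsum 0]⟩ ⟨0, h⟩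
  refine ⟨m a, a, o a, ⟨hangle a, rfl⟩, ⟨?_, ?_⟩, ha, ?_⟩
  · rw [← hoo, hangle]
  · rw [← hmo, ← hoo]
  · have h := hsum a
    simp only [hΦ, hmo, hoo] at h ha
    linarith

end IsConvexLoop

/-! ### The inequalities of Gage, Green–Osher and Bonnesen -/

lemma integral_eq_add_of_periodic {f : ℝ → ℝ} {p : ℝ} (hf : Continuous f)
    (hp : Function.Periodic f p) (a b : ℝ) :
    ∫ u in (0 : ℝ)..p, f u = (∫ u in a..b, f u) + ∫ u in b..a + p, f u := by
  rw [intervalIntegral.integral_add_adjacent_intervals (hf.intervalIntegrable _ _)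
    (hf.intervalIntegrable _ _), hp.intervalIntegral_add_eq a 0, zero_add]

lemma sq_sub_le_of_bonnesen {R h l l' : ℝ} (hR : 0 ≤ R) (hl : π * R ≤ l) (hl' : π * R ≤ l')
    (hbonnesen : π * R ^ 2 - 2 * h * l + π * h ^ 2 ≤ 0) :
    (h - R) ^ 2 ≤ (l + l') ^ 2 - (2 * (π * R)) ^ 2 := by
  have hπR : 0 ≤ π * R := mul_nonneg Real.pi_pos.le hR
  have hh : (π * h - l) ^ 2 ≤ l ^ 2 - (π * R) ^ 2 := by nlinarith [Real.pi_pos]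
  have hlR : (l - π * R) ^ 2 ≤ l ^ 2 - (π * R) ^ 2 := by nlinarith
  have hhR : π ^ 2 * (h - R) ^ 2 ≤ 4 * (l ^ 2 - (π * R) ^ 2) := by
    nlinarith [sq_nonneg (π * h - l - (l - π * R))]
  have hfour : 4 * (h - R) ^ 2 ≤ π ^ 2 * (h - R) ^ 2 :=
    mul_le_mul_of_nonneg_right (by nlinarith [Real.pi_gt_three]) (sq_nonneg _)
  nlinarith

/-- The elastic energy `∮ κ² ds`. -/
noncomputable def elasticEnergy (γ : ℝ → Plane) : ℝ :=
  ∫ u in (0 : ℝ)..2 * π, curvature γ u ^ 2 * metric γ u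

namespace IsRegularLoop

variable {γ : ℝ → Plane}

lemma length_pos (hγ : IsRegularLoop γ) : 0 < length γ :=
  intervalIntegral.intervalIntegral_pos_of_pos (hγ.continuous_metric.intervalIntegrable _ _)
    hγ.metric_pos Real.two_pi_pos

lemma integral_support_mul_turningRate_eq_length (hγ : IsRegularLoop γ) (c : Plane) :
    ∫ u in (0 : ℝ)..2 * π, support γ c u * turningRate γ u = length γ :=
  hγ.integral_support_mul_turningRate (by simpa using (hγ.periodic_tangential c 0).symm)

end IsRegularLoop

namespace IsConvexLoop

variable {γ : ℝ → Plane}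

/-- The family of inequalities whose optimal member, `k = π / A`, is Gage's inequality. -/
lemma two_mul_mul_length_le (hγ : IsConvexLoop γ) (k : ℝ) :
    2 * k * length γ ≤ elasticEnergy γ + k ^ 2 * (area γ * length γ / π) := by
  obtain ⟨c, a, b, hab, hba, hA, hA'⟩ := hγ.exists_bisecting_isHalfTurn
  have hg := hγ.continuous_metric
  have hκ := hγ.continuous_curvature
  have hw := hγ.continuous_turningRate
  have hs := hγ.continuous_support c
  have hsupport : ∫ u in (0 : ℝ)..2 * π, support γ c u ^ 2 * metric γ u ≤
      area γ * length γ / π := by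
    have hleft := hab.pi_mul_integral_support_sq_mul_metric_le hγ
    have hright := hba.pi_mul_integral_support_sq_mul_metric_le hγ
    rw [hA] at hleft
    rw [hA'] at hright
    rw [le_div_iff₀' Real.pi_pos, length, integral_eq_add_of_periodic hg hγ.periodic_metric a b,
      integral_eq_add_of_periodic (by fun_prop)
        (fun u => by simp only [hγ.periodic_support c u, hγ.periodic_metric u]) a b]
    linarith
  have hsq : 0 ≤ ∫ u in (0 : ℝ)..2 * π, (curvature γ u - k * support γ c u) ^ 2 * metric γ u :=
    intervalIntegral.integral_nonneg Real.two_pi_pos.le fun u _ =>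
      mul_nonneg (sq_nonneg _) (hγ.metric_pos u).le
  have hexpand (u : ℝ) : (curvature γ u - k * support γ c u) ^ 2 * metric γ u =
      curvature γ u ^ 2 * metric γ u - 2 * k * (support γ c u * turningRate γ u) +
        k ^ 2 * (support γ c u ^ 2 * metric γ u) := by
    rw [turningRate]
    ring
  simp (disch := exact Continuous.intervalIntegrable (by fun_prop) _ _) only
    [hexpand, intervalIntegral.integral_sub, intervalIntegral.integral_add,
      intervalIntegral.integral_const_mul, hγ.integral_support_mul_turningRate_eq_length] at hsq
  rw [elasticEnergy]
  linarith [mul_le_mul_of_nonneg_left hsupport (sq_nonneg k)]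

lemma area_pos (hγ : IsConvexLoop γ) : 0 < area γ := by
  by_contra! hA
  have hL := hγ.length_pos
  have h := hγ.two_mul_mul_length_le ((elasticEnergy γ + 1) / length γ)
  have hnonpos : ((elasticEnergy γ + 1) / length γ) ^ 2 * (area γ * length γ / π) ≤ 0 :=
    mul_nonpos_of_nonneg_of_nonpos (sq_nonneg _)
      (div_nonpos_of_nonpos_of_nonneg (mul_nonpos_of_nonpos_of_nonneg hA hL.le) Real.pi_pos.le)
  have henergy : 0 ≤ elasticEnergy γ :=
    intervalIntegral.integral_nonneg Real.two_pi_pos.le fun u _ =>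
      mul_nonneg (sq_nonneg _) (hγ.metric_pos u).le
  rw [mul_assoc, div_mul_cancel₀ _ hL.ne'] at h
  linarith

/-- **Gage's inequality**. -/
theorem pi_mul_length_div_area_le (hγ : IsConvexLoop γ) :
    π * length γ / area γ ≤ elasticEnergy γ := by
  have hA := hγ.area_pos
  have h := hγ.two_mul_mul_length_le (π / area γ)
  have heq : (π / area γ) ^ 2 * (area γ * length γ / π) = π * length γ / area γ := by
    field_simp
  have heq' : 2 * (π / area γ) * length γ = 2 * (π * length γ / area γ) := by ring
  linarith

/-- The **Green–Osher inequality**. -/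
theorem le_integral_inv_curvature (hγ : IsConvexLoop γ) :
    (length γ ^ 2 - 2 * π * area γ) / π ≤
      ∫ u in (0 : ℝ)..2 * π, 1 / curvature γ u * metric γ u := by
  obtain ⟨c, a, b, hab, hba, hA, hA'⟩ := hγ.exists_bisecting_isHalfTurn
  have hleft := hab.le_integral_inv_curvature hγ
  have hright := hba.le_integral_inv_curvature hγ
  rw [hA] at hleft
  rw [hA'] at hright
  have hcont : Continuous fun u => 1 / curvature γ u * metric γ u :=
    (continuous_const.div hγ.continuous_curvature fun u => (hγ.curvature_pos u).ne').mul
      hγ.continuous_metric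
  have hper : Function.Periodic (fun u => 1 / curvature γ u * metric γ u) (2 * π) := fun u => by
    simp only [hγ.periodic_curvature u, hγ.periodic_metric u]
  rw [length, integral_eq_add_of_periodic hγ.continuous_metric hγ.periodic_metric a b,
    integral_eq_add_of_periodic hcont hper a b]
  refine le_trans ?_ (add_le_add hleft hright)
  rw [div_sub' Real.pi_pos.ne', div_sub' Real.pi_pos.ne', ← add_div]
  refine div_le_div_of_nonneg_right ?_ Real.pi_pos.le
  linarith [sq_nonneg ((∫ u in a..b, metric γ u) - ∫ u in b..a + 2 * π, metric γ u)]

/-- **Bonnesen's inequality**. -/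
theorem exists_sq_support_sub_le (hγ : IsConvexLoop γ) :
    ∃ c, ∀ u, (support γ c u - √(area γ / π)) ^ 2 ≤ deficit γ := by
  obtain ⟨c, a, b, hab, hba, hA, hA'⟩ := hγ.exists_bisecting_isHalfTurn
  refine ⟨c, fun u => ?_⟩
  set R := √(area γ / π)
  have hR : 0 ≤ R := Real.sqrt_nonneg _
  have hRA : area γ = π * R ^ 2 := by
    rw [Real.sq_sqrt (div_pos hγ.area_pos Real.pi_pos).le, mul_div_cancel₀ _ Real.pi_pos.ne']
  have hhalf {a b : ℝ} (h : IsHalfTurn γ c a b)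
      (hA : ∫ u in a..b, support γ c u * metric γ u = area γ) :
      π * R ≤ ∫ u in a..b, metric γ u := by
    have hl := h.pi_mul_integral_support_mul_metric_le_sq hγ
    rw [hA, hRA, ← mul_assoc, ← sq, ← mul_pow] at hl
    exact (abs_le_of_sq_le_sq' hl (intervalIntegral.integral_nonneg (h.lt hγ).le
      fun u _ => (hγ.metric_pos u).le)).2
  have hdeficit : deficit γ = ((∫ u in a..b, metric γ u) +
      ∫ u in b..a + 2 * π, metric γ u) ^ 2 - (2 * (π * R)) ^ 2 := by
    rw [deficit, length, hRA, ← integral_eq_add_of_periodic hγ.continuous_metric hγ.periodic_metric]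
    ring
  rw [hdeficit]
  obtain ⟨v, hv, huv⟩ := (hγ.periodic_support c).exists_mem_Ico Real.two_pi_pos u a
  rw [huv]
  rcases le_total v b with hvb | hbv
  · refine sq_sub_le_of_bonnesen hR (hhalf hab hA) (hhalf hba hA') ?_
    rw [← hRA, ← hA]
    exact hab.bonnesen hγ ⟨hv.1, hvb⟩
  · rw [add_comm]
    refine sq_sub_le_of_bonnesen hR (hhalf hba hA') (hhalf hab hA) ?_
    rw [← hRA, ← hA']
    exact hba.bonnesen hγ ⟨hbv, hv.2.le⟩

theorem deficit_nonneg (hγ : IsConvexLoop γ) : 0 ≤ deficit γ := by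
  obtain ⟨c, hc⟩ := hγ.exists_sq_support_sub_le
  exact (sq_nonneg _).trans (hc 0)

end IsConvexLoop

namespace IsStrictlyConvexClosed

variable {γ : ℝ → Plane}

lemma isRegularLoop (hγ : IsStrictlyConvexClosed γ) : IsRegularLoop γ :=
  ⟨hγ.smooth, hγ.periodic, hγ.regular⟩

lemma eq_of_support_eq_zero (hγ : IsStrictlyConvexClosed γ) {u v : ℝ}
    (h : support γ (γ v) u = 0) : γ u = γ v := by
  have hmin : IsLocalMin (support γ (γ v)) u :=
    Eventually.of_forall fun s => h.trans_le (hγ.convex s v)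
  have htangential : tangential γ (γ v) u = 0 :=
    (mul_eq_zero.1 (hmin.hasDerivAt_eq_zero (hγ.isRegularLoop.hasDerivAt_support _ _))).resolve_left
      (mul_pos (hγ.curvature_pos u) (hγ.isRegularLoop.metric_pos u)).ne'
  rw [← sub_eq_zero, hγ.isRegularLoop.sub_eq_tangential_smul_sub_support_smul, h, htangential,
    zero_smul, zero_smul, sub_zero]

/-- A curve whose tangent turns further than once has two points with the same tangent, which by
convexity lie on the same tangent line and hence coincide. -/
theorem isConvexLoop (hγ : IsStrictlyConvexClosed γ) : IsConvexLoop γ := by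
  have hγ' := hγ.isRegularLoop
  refine ⟨hγ', hγ.curvature_pos, ?_⟩
  have hzero : angle γ 0 = 0 := intervalIntegral.integral_same
  have hpos : 0 < angle γ (2 * π) :=
    intervalIntegral.intervalIntegral_pos_of_pos
      (hγ'.continuous_turningRate.intervalIntegrable _ _)
      (fun u => mul_pos (hγ.curvature_pos u) (hγ'.metric_pos u)) Real.two_pi_pos
  change angle γ (2 * π) = 2 * π
  refine le_antisymm (not_lt.1 fun hlt => ?_) (not_lt.1 fun hlt => ?_)
  · obtain ⟨u, hu, hangle⟩ := intermediate_value_Ioo Real.two_pi_pos.le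
      hγ'.continuous_angle.continuousOn ⟨hzero.trans_lt Real.two_pi_pos, hlt⟩
    have htangent : tangent γ u = tangent γ 0 := by
      simpa [hangle] using hγ'.tangent_eq_cos_angle_smul_add u
    have hsupport : support γ (γ 0) u = 0 := by
      refine le_antisymm ?_ (hγ.convex u 0)
      rw [support, ← neg_sub, inner_neg_left, normal, htangent]
      exact neg_nonpos.2 (hγ.convex 0 u)
    exact hu.1.ne' (hγ.simple ⟨hu.1.le, hu.2⟩ ⟨le_rfl, Real.two_pi_pos⟩
      (hγ.eq_of_support_eq_zero hsupport))
  · have hcos : Real.cos (angle γ (2 * π)) = 1 := by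
      have h := congrArg (inner ℝ (tangent γ 0)) (hγ'.tangent_eq_cos_angle_smul_add (2 * π))
      rw [← zero_add (2 * π), hγ'.periodic_tangent, zero_add, inner_add_right,
        real_inner_smul_right, real_inner_smul_right, normal, inner_self_rot,
        hγ'.inner_tangent_tangent] at h
      linarith
    exact hpos.ne' ((Real.cos_eq_one_iff_of_lt_of_lt (by linarith) hlt).1 hcos)

end IsStrictlyConvexClosed

/-! ### The Steiner point -/

lemma integral_eq_zero_of_periodic_of_hasDerivAt {E : Type*} [NormedAddCommGroup E]
    [NormedSpace ℝ E] [CompleteSpace E] {f f' : ℝ → E} {p : ℝ} (hp : Function.Periodic f p)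
    (hf : ∀ u, HasDerivAt f (f' u) u) (hf' : Continuous f') : ∫ u in (0 : ℝ)..p, f' u = 0 := by
  rw [intervalIntegral.integral_eq_sub_of_hasDerivAt (fun u _ => hf u)
    (hf'.intervalIntegrable _ _), hp.eq, sub_self]

/-- The Steiner point, the centre of mass of the curve weighted by its curvature. -/
noncomputable def steinerPoint (γ : ℝ → Plane) : Plane :=
  (2 * π)⁻¹ • ∫ u in (0 : ℝ)..2 * π, turningRate γ u • γ u

namespace IsRegularLoop

variable {γ : ℝ → Plane} {c : Plane}

lemma integral_metric_smul_normal (hγ : IsRegularLoop γ) :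
    ∫ u in (0 : ℝ)..2 * π, metric γ u • normal γ u = 0 := by
  have hg := hγ.continuous_metric
  have hN := hγ.continuous_normal
  refine integral_eq_zero_of_periodic_of_hasDerivAt (hγ.periodic.comp rot) (fun u => ?_)
    (by fun_prop)
  exact (hasDerivAt_rot (hγ.hasDerivAt u)).congr_deriv (rot_smul _ _)

lemma integral_turningRate_smul_normal (hγ : IsRegularLoop γ) :
    ∫ u in (0 : ℝ)..2 * π, turningRate γ u • normal γ u = 0 :=
  integral_eq_zero_of_periodic_of_hasDerivAt hγ.periodic_tangent hγ.hasDerivAt_tangent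
    (hγ.continuous_turningRate.smul hγ.continuous_normal)

lemma norm_sub_le_of_abs_support_le (hγ : IsRegularLoop γ) {M : ℝ}
    (h : ∀ u, |support γ c u| ≤ M) (u : ℝ) : ‖γ u - c‖ ≤ M := by
  have hcont : Continuous fun s => ‖γ s - c‖ := (hγ.continuous.sub continuous_const).norm
  obtain ⟨v, -, hv⟩ := isCompact_Icc.exists_isMaxOn (nonempty_Icc.2 Real.two_pi_pos.le)
    hcont.continuousOn
  have hmax (s : ℝ) : ‖γ s - c‖ ≤ ‖γ v - c‖ := by
    obtain ⟨s', hs', hss'⟩ := hγ.periodic.exists_mem_Ico₀ Real.two_pi_pos s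
    rw [hss']
    exact hv (Ico_subset_Icc_self hs')
  have hderiv : 2 * ⟪γ v - c, metric γ v • tangent γ v⟫ = 0 :=
    IsLocalMax.hasDerivAt_eq_zero
      (Eventually.of_forall fun s => pow_le_pow_left₀ (norm_nonneg _) (hmax s) 2)
      ((hγ.hasDerivAt v).sub_const c).norm_sq
  have htangential : tangential γ c v = 0 := by
    rw [real_inner_smul_right] at hderiv
    exact (mul_eq_zero.1 ((mul_eq_zero.1 hderiv).resolve_left two_ne_zero)).resolve_left
      (hγ.metric_pos v).ne'
  calc ‖γ u - c‖ ≤ ‖γ v - c‖ := hmax u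
    _ = |support γ c v| := by
      rw [hγ.sub_eq_tangential_smul_sub_support_smul, htangential, zero_smul, zero_sub, norm_neg,
        norm_smul, hγ.norm_normal, mul_one, Real.norm_eq_abs]
    _ ≤ M := h v

lemma dist_sub_smul_normal_le (hγ : IsRegularLoop γ) {R ε : ℝ} (hR : 0 ≤ R)
    (h : ∀ u, |support γ c u - R| ≤ ε) (u : ℝ) :
    dist (γ u) (c - R • normal γ u) ≤ √(4 * R * ε + ε ^ 2) := by
  have hnorm : ‖γ u - c‖ ≤ R + ε := hγ.norm_sub_le_of_abs_support_le (fun v => by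
    have hv := abs_le.1 (h v)
    exact abs_le.2 ⟨by linarith, by linarith⟩) u
  have hsupport : ⟪γ u - c, normal γ u⟫ = -support γ c u := by
    rw [support, ← neg_sub (γ u) c, inner_neg_left, neg_neg]
  refine Real.le_sqrt_of_sq_le ?_
  rw [dist_eq_norm, sub_sub_eq_add_sub, add_sub_right_comm, norm_add_sq_real,
    real_inner_smul_right, hsupport, norm_smul, hγ.norm_normal, mul_one, Real.norm_eq_abs, sq_abs]
  nlinarith [abs_le.1 (h u), norm_nonneg (γ u - c)]

end IsRegularLoop

namespace IsConvexLoop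

variable {γ : ℝ → Plane} {c : Plane} {R : ℝ}

/-- As `∮ N ds = ∮ κ N ds = 0`, the factor `κ² - a` may be replaced by `(κ - m)²`, where
`m = 2π / L` is the mean curvature. -/
lemma norm_integral_sub_const_mul_metric_smul_normal_le (hγ : IsConvexLoop γ) (a : ℝ) :
    ‖∫ u in (0 : ℝ)..2 * π, ((curvature γ u ^ 2 - a) * metric γ u) • normal γ u‖ ≤
      elasticEnergy γ - 4 * π ^ 2 / length γ := by
  have hg := hγ.continuous_metric
  have hκ := hγ.continuous_curvature
  have hw := hγ.continuous_turningRate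
  have hN := hγ.continuous_normal
  have hL := hγ.length_pos
  set m := 2 * π / length γ with hm
  have hsplit (u : ℝ) : ((curvature γ u ^ 2 - a) * metric γ u) • normal γ u =
      ((curvature γ u - m) ^ 2 * metric γ u) • normal γ u +
        (2 * m) • (turningRate γ u • normal γ u) - (m ^ 2 + a) • (metric γ u • normal γ u) := by
    rw [turningRate]
    module
  have hexpand (u : ℝ) : (curvature γ u - m) ^ 2 * metric γ u =
      curvature γ u ^ 2 * metric γ u - 2 * m * turningRate γ u + m ^ 2 * metric γ u := by
    rw [turningRate]
    ring
  simp (disch := exact Continuous.intervalIntegrable (by fun_prop) _ _) only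
    [hsplit, intervalIntegral.integral_sub, intervalIntegral.integral_add,
      intervalIntegral.integral_smul, hγ.integral_metric_smul_normal,
      hγ.integral_turningRate_smul_normal, smul_zero, add_zero, sub_zero]
  calc ‖∫ u in (0 : ℝ)..2 * π, ((curvature γ u - m) ^ 2 * metric γ u) • normal γ u‖
      ≤ ∫ u in (0 : ℝ)..2 * π, (curvature γ u - m) ^ 2 * metric γ u := by
        refine (intervalIntegral.norm_integral_le_integral_norm Real.two_pi_pos.le).trans_eq ?_
        refine intervalIntegral.integral_congr fun u _ => ?_
        simp only [norm_smul, hγ.norm_normal, mul_one]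
        exact Real.norm_of_nonneg (mul_nonneg (sq_nonneg _) (hγ.metric_pos u).le)
    _ = elasticEnergy γ - 2 * m * (2 * π) + m ^ 2 * length γ := by
        simp (disch := exact Continuous.intervalIntegrable (by fun_prop) _ _) only
          [hexpand, intervalIntegral.integral_sub, intervalIntegral.integral_add,
            intervalIntegral.integral_const_mul, hγ.integral_turningRate]
        rfl
    _ = elasticEnergy γ - 4 * π ^ 2 / length γ := by
        rw [hm]
        field_simp
        ring

lemma steinerPoint_sub_eq (hγ : IsConvexLoop γ) (c : Plane) (R : ℝ) :
    steinerPoint γ - c =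
      -(π⁻¹ • ∫ u in (0 : ℝ)..2 * π, ((support γ c u - R) * turningRate γ u) • normal γ u) := by
  have hγc := hγ.continuous
  have hw := hγ.continuous_turningRate
  have hN := hγ.continuous_normal
  have hs := hγ.continuous_support c
  have hderiv (u : ℝ) : HasDerivAt (fun v => (support γ c v - 2 * R) • tangent γ v)
      (turningRate γ u • γ u - turningRate γ u • c +
        (2 : ℝ) • ((support γ c u - R) * turningRate γ u) • normal γ u) u := by
    refine (((hγ.hasDerivAt_support c u).sub_const (2 * R)).smul
      (hγ.hasDerivAt_tangent u)).congr_deriv ?_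
    rw [← smul_sub, hγ.sub_eq_tangential_smul_sub_support_smul]
    module
  have key := integral_eq_zero_of_periodic_of_hasDerivAt (p := 2 * π)
    (fun u => by simp only [hγ.periodic_support c u, hγ.periodic_tangent u]) hderiv (by fun_prop)
  simp (disch := exact Continuous.intervalIntegrable (by fun_prop) _ _) only
    [intervalIntegral.integral_add, intervalIntegral.integral_sub, intervalIntegral.integral_smul,
      intervalIntegral.integral_smul_const, hγ.integral_turningRate] at key
  rw [steinerPoint]
  linear_combination (norm := (match_scalars <;> field_simp <;> ring)) (2 * π)⁻¹ • key

lemma norm_steinerPoint_sub_le (hγ : IsConvexLoop γ) {δ : ℝ}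
    (h : ∀ u, |support γ c u - R| ≤ δ) : ‖steinerPoint γ - c‖ ≤ 2 * δ := by
  rw [hγ.steinerPoint_sub_eq c R, norm_neg, norm_smul,
    Real.norm_of_nonneg (inv_pos.2 Real.pi_pos).le, inv_mul_le_iff₀ Real.pi_pos]
  calc ‖∫ u in (0 : ℝ)..2 * π, ((support γ c u - R) * turningRate γ u) • normal γ u‖
      ≤ ∫ u in (0 : ℝ)..2 * π, δ * turningRate γ u := by
        refine intervalIntegral.norm_integral_le_of_norm_le Real.two_pi_pos.le
          (Eventually.of_forall fun u _ => ?_)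
          ((hγ.continuous_turningRate.intervalIntegrable _ _).const_mul _)
        rw [norm_smul, hγ.norm_normal, mul_one, norm_mul, Real.norm_eq_abs,
          Real.norm_of_nonneg (hγ.turningRate_pos u).le]
        exact mul_le_mul_of_nonneg_right (h u) (hγ.turningRate_pos u).le
    _ = π * (2 * δ) := by
        rw [intervalIntegral.integral_const_mul, hγ.integral_turningRate]
        ring

theorem abs_support_sub_le (hγ : IsConvexLoop γ) (c : Plane) (u : ℝ) :
    |support γ c u - √(area γ / π)| ≤ 3 * √(deficit γ) + ‖steinerPoint γ - c‖ := by
  obtain ⟨p, hp⟩ := hγ.exists_sq_support_sub_le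
  have habs (v : ℝ) : |support γ p v - √(area γ / π)| ≤ √(deficit γ) := Real.abs_le_sqrt (hp v)
  have hpc : |support γ c u - support γ p u| ≤ ‖c - p‖ := by
    rw [support, support, ← inner_sub_left, sub_sub_sub_cancel_right]
    exact (abs_real_inner_le_norm _ _).trans_eq (by rw [hγ.norm_normal, mul_one])
  have hσ := hγ.norm_steinerPoint_sub_le habs
  have htri := norm_sub_le_norm_sub_add_norm_sub c (steinerPoint γ) p
  rw [norm_sub_rev c (steinerPoint γ)] at htri
  linarith [abs_sub_le (support γ c u) (support γ p u) (√(area γ / π)), habs u]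

lemma exists_normal_eq (hγ : IsConvexLoop γ) {v : Plane} (hv : ‖v‖ = 1) : ∃ u, normal γ u = v := by
  obtain ⟨θ, hθ⟩ := exists_cos_smul_add_sin_smul_rot (hγ.norm_tangent 0) (w := -rot v)
    (by rw [norm_neg, norm_rot, hv])
  obtain ⟨u, rfl⟩ := hγ.surjective_angle θ
  refine ⟨u, ?_⟩
  rw [normal, hγ.tangent_eq_cos_angle_smul_add, normal, ← hθ, rot_neg, rot_rot, neg_neg]

theorem hausdorffDist_range_sphere_le (hγ : IsConvexLoop γ) {ε : ℝ} (hR : 0 < R)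
    (h : ∀ u, |support γ c u - R| ≤ ε) :
    Metric.hausdorffDist (range γ) (Metric.sphere c R) ≤ √(4 * R * ε + ε ^ 2) := by
  refine Metric.hausdorffDist_le_of_mem_dist (Real.sqrt_nonneg _) ?_ fun z hz => ?_
  · rintro _ ⟨u, rfl⟩
    refine ⟨_, ?_, hγ.dist_sub_smul_normal_le hR.le h u⟩
    rw [mem_sphere_iff_norm, sub_sub_cancel_left, norm_neg, norm_smul, hγ.norm_normal, mul_one,
      Real.norm_of_nonneg hR.le]
  · rw [mem_sphere_iff_norm] at hz
    obtain ⟨u, hu⟩ := hγ.exists_normal_eq (v := R⁻¹ • (c - z)) (by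
      rw [norm_smul, norm_sub_rev, hz, norm_inv, Real.norm_of_nonneg hR.le,
        inv_mul_cancel₀ hR.ne'])
    have h' := hγ.dist_sub_smul_normal_le hR.le h u
    rw [hu, smul_inv_smul₀ hR.ne', sub_sub_cancel, dist_comm] at h'
    exact ⟨γ u, mem_range_self u, h'⟩

end IsConvexLoop

/-! ### Smooth families of functions -/

/-- The partial derivative of a family `F u t` with respect to the curve parameter `u`. -/
noncomputable def paramDeriv {E : Type*} [NormedAddCommGroup E] [NormedSpace ℝ E]
    (F : ℝ → ℝ → E) (u t : ℝ) : E := deriv (fun v => F v t) u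

/-- The partial derivative of a family `F u t` with respect to time `t`. -/
noncomputable def timeDeriv {E : Type*} [NormedAddCommGroup E] [NormedSpace ℝ E]
    (F : ℝ → ℝ → E) (u t : ℝ) : E := deriv (fun τ => F u τ) t

/-- A family `F u t` which is jointly smooth in the parameter `u : ℝ` and the time `t ∈ I`. -/
def IsSmoothFamily {E : Type*} [NormedAddCommGroup E] [NormedSpace ℝ E] (I : Set ℝ)
    (F : ℝ → ℝ → E) : Prop :=
  ContDiffOn ℝ ∞ (fun p : ℝ × ℝ => F p.1 p.2) (univ ×ˢ I)

namespace IsSmoothFamily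

variable {E : Type*} [NormedAddCommGroup E] [NormedSpace ℝ E] {F : ℝ → ℝ → E} {I J : Set ℝ}
  {t : ℝ}

lemma mono (hF : IsSmoothFamily I F) (hJI : J ⊆ I) : IsSmoothFamily J F :=
  ContDiffOn.mono hF (prod_mono_right hJI)

lemma contDiff_left (hF : IsSmoothFamily I F) (ht : t ∈ I) : ContDiff ℝ ∞ fun u => F u t :=
  hF.comp_contDiff (contDiff_id.prodMk contDiff_const) fun _ => ⟨mem_univ _, ht⟩

lemma continuous_left (hF : IsSmoothFamily I F) (ht : t ∈ I) : Continuous fun u => F u t :=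
  (hF.contDiff_left ht).continuous

lemma continuousOn_right (hF : IsSmoothFamily I F) (u : ℝ) : ContinuousOn (fun t => F u t) I :=
  hF.continuousOn.comp (f := fun t => (u, t)) (by fun_prop) fun _ ht => ⟨mem_univ _, ht⟩

lemma hasDerivAt_left (hF : IsSmoothFamily I F) (ht : t ∈ I) (u : ℝ) :
    HasDerivAt (fun v => F v t) (paramDeriv F u t) u :=
  ((hF.contDiff_left ht).differentiable (by simp) u).hasDerivAt

lemma hasDerivAt_left_fderivWithin (hF : IsSmoothFamily I F) (ht : t ∈ I) (u : ℝ) :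
    HasDerivAt (fun v => F v t)
      (fderivWithin ℝ (fun p : ℝ × ℝ => F p.1 p.2) (univ ×ˢ I) (u, t) (1, 0)) u := by
  have hpair : HasDerivWithinAt (fun v : ℝ => (v, t)) ((1 : ℝ), (0 : ℝ)) univ u :=
    ((hasDerivAt_id u).prodMk (hasDerivAt_const u t)).hasDerivWithinAt
  exact hasDerivWithinAt_univ.1
    ((hF.differentiableOn (by simp) _ ⟨mem_univ _, ht⟩).hasFDerivWithinAt.comp_hasDerivWithinAt u
      hpair fun v _ => mk_mem_prod (mem_univ v) ht)

protected lemma paramDeriv (hF : IsSmoothFamily I F) (hI : UniqueDiffOn ℝ I) :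
    IsSmoothFamily I (paramDeriv F) :=
  ((hF.fderivWithin (uniqueDiffOn_univ.prod hI) (by simp)).clm_apply contDiffOn_const).congr
    fun p hp => (hF.hasDerivAt_left_fderivWithin hp.2 p.1).deriv

lemma hasDerivAt_right_fderiv (hF : IsSmoothFamily J F) (hJ : IsOpen J) (ht : t ∈ J) (u : ℝ) :
    HasDerivAt (fun τ => F u τ) (fderiv ℝ (fun p : ℝ × ℝ => F p.1 p.2) (u, t) (0, 1)) t :=
  HasFDerivAt.comp_hasDerivAt t
    ((hF.contDiffAt ((isOpen_univ.prod hJ).mem_nhds ⟨mem_univ _, ht⟩)).differentiableAt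
      (by simp)).hasFDerivAt ((hasDerivAt_const t u).prodMk (hasDerivAt_id t))

lemma hasDerivAt_right (hF : IsSmoothFamily J F) (hJ : IsOpen J) (ht : t ∈ J) (u : ℝ) :
    HasDerivAt (fun τ => F u τ) (timeDeriv F u t) t :=
  (hF.hasDerivAt_right_fderiv hJ ht u).differentiableAt.hasDerivAt

protected lemma timeDeriv (hF : IsSmoothFamily J F) (hJ : IsOpen J) :
    IsSmoothFamily J (timeDeriv F) :=
  ((hF.fderiv_of_isOpen (isOpen_univ.prod hJ) (by simp)).clm_apply contDiffOn_const).congr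
    fun p hp => (hF.hasDerivAt_right_fderiv hJ hp.2 p.1).deriv

lemma hasDerivAt_paramDeriv (hF : IsSmoothFamily J F) (hJ : IsOpen J) (ht : t ∈ J) (u : ℝ) :
    HasDerivAt (fun τ => paramDeriv F u τ) (paramDeriv (timeDeriv F) u t) t := by
  set f : ℝ × ℝ → E := fun p => F p.1 p.2
  have hopen : IsOpen ((univ : Set ℝ) ×ˢ J) := isOpen_univ.prod hJ
  have hnhds : (univ : Set ℝ) ×ˢ J ∈ 𝓝 (u, t) := hopen.mem_nhds ⟨mem_univ _, ht⟩
  have hf' (w : ℝ × ℝ) : HasFDerivAt (fun p => fderiv ℝ f p w)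
      ((ContinuousLinearMap.apply ℝ E w).comp (fderiv ℝ (fderiv ℝ f) (u, t))) (u, t) :=
    (ContinuousLinearMap.apply ℝ E w).hasFDerivAt.comp _
      (((hF.fderiv_of_isOpen hopen (m := ∞) (by simp)).contDiffAt hnhds).differentiableAt
        (by simp)).hasFDerivAt
  have hsymm : fderiv ℝ (fderiv ℝ f) (u, t) (0, 1) (1, 0) =
      fderiv ℝ (fderiv ℝ f) (u, t) (1, 0) (0, 1) :=
    ((hF.contDiffAt hnhds).isSymmSndFDerivAt
      (by simpa using (ENat.LEInfty.out : (2 : WithTop ℕ∞) ≤ ∞))).eq _ _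
  have hparam : HasDerivAt (fun v => timeDeriv F v t)
      (fderiv ℝ (fderiv ℝ f) (u, t) (1, 0) (0, 1)) u := by
    refine ((hf' (0, 1)).comp_hasDerivAt u
      ((hasDerivAt_id u).prodMk (hasDerivAt_const u t))).congr_of_eventuallyEq ?_
    exact Eventually.of_forall fun v => (hF.hasDerivAt_right_fderiv hJ ht v).deriv
  have htime : HasDerivAt (fun τ => paramDeriv F u τ)
      (fderiv ℝ (fderiv ℝ f) (u, t) (0, 1) (1, 0)) t := by
    refine ((hf' (1, 0)).comp_hasDerivAt t
      ((hasDerivAt_const t u).prodMk (hasDerivAt_id t))).congr_of_eventuallyEq ?_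
    filter_upwards [hJ.mem_nhds ht] with τ hτ
    rw [paramDeriv, (hF.hasDerivAt_left_fderivWithin hτ u).deriv,
      fderivWithin_of_isOpen hopen ⟨mem_univ _, hτ⟩]
    rfl
  rw [hsymm] at htime
  exact htime.congr_deriv hparam.deriv.symm

lemma continuousOn_integral (hF : IsSmoothFamily I F) (a b : ℝ) :
    ContinuousOn (fun t => ∫ u in a..b, F u t) I := by
  rw [continuousOn_iff_continuous_domRestrict]
  exact intervalIntegral.continuous_parametric_intervalIntegral_of_continuous'
    (f := fun (s : I) u => F u s)
    (hF.continuousOn.comp_continuous (f := fun p : I × ℝ => (p.2, (p.1 : ℝ))) (by fun_prop)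
      fun p => ⟨mem_univ _, p.1.2⟩) a b

lemma hasDerivAt_integral (hF : IsSmoothFamily J F) (hJ : IsOpen J) (ht : t ∈ J) (a b : ℝ) :
    HasDerivAt (fun τ => ∫ u in a..b, F u τ) (∫ u in a..b, timeDeriv F u t) t := by
  obtain ⟨ε, hε, hball⟩ := Metric.nhds_basis_closedBall.mem_iff.1 (hJ.mem_nhds ht)
  obtain ⟨C, hC⟩ := (isCompact_uIcc.prod (isCompact_closedBall t ε)).exists_bound_of_continuousOn
    ((hF.timeDeriv hJ).continuousOn.mono (prod_mono (subset_univ (uIcc a b)) hball))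
  refine (intervalIntegral.hasDerivAt_integral_of_dominated_loc_of_deriv_le
    (F := fun τ u => F u τ) (F' := fun τ u => timeDeriv F u τ) (bound := fun _ => C)
    (Metric.closedBall_mem_nhds t hε) ?_ ?_ ?_ ?_ ?_ ?_).2
  · filter_upwards [hJ.mem_nhds ht] with τ hτ
    exact (hF.continuous_left hτ).aestronglyMeasurable
  · exact (hF.continuous_left ht).intervalIntegrable _ _
  · exact ((hF.timeDeriv hJ).continuous_left ht).aestronglyMeasurable
  · exact Eventually.of_forall fun u hu τ hτ => hC (u, τ) ⟨uIoc_subset_uIcc hu, hτ⟩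
  · exact continuous_const.intervalIntegrable _ _
  · exact Eventually.of_forall fun u _ τ hτ => hF.hasDerivAt_right hJ (hball hτ) u

end IsSmoothFamily

/-! ### Variation of closed curves -/

/-- A jointly smooth family of regular closed curves `u ↦ X u t`, for times `t ∈ I`. -/
structure IsLoopFamily (I : Set ℝ) (X : ℝ → ℝ → Plane) : Prop where
  isSmoothFamily : IsSmoothFamily I X
  isRegularLoop : ∀ t ∈ I, IsRegularLoop fun u => X u t

/-- The angular velocity `φ = ⟪T_t, N⟫` of the tangent of a moving curve, in terms of the velocity
of the curve. -/
noncomputable def rotationRate (X : ℝ → ℝ → Plane) (u t : ℝ) : ℝ :=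
  (metric (fun v => X v t) u)⁻¹ * ⟪paramDeriv (timeDeriv X) u t, normal (fun v => X v t) u⟫

/-- The normal component of the velocity of a moving curve. -/
noncomputable def normalSpeed (X : ℝ → ℝ → Plane) (u t : ℝ) : ℝ :=
  ⟪timeDeriv X u t, normal (fun v => X v t) u⟫

namespace IsLoopFamily

variable {I J : Set ℝ} {X : ℝ → ℝ → Plane} {t : ℝ}

lemma mono (hX : IsLoopFamily I X) (hJI : J ⊆ I) : IsLoopFamily J X :=
  ⟨hX.isSmoothFamily.mono hJI, fun t ht => hX.isRegularLoop t (hJI ht)⟩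

lemma isSmoothFamily_metric (hX : IsLoopFamily I X) (hI : UniqueDiffOn ℝ I) :
    IsSmoothFamily I fun u t => metric (fun v => X v t) u :=
  (hX.isSmoothFamily.paramDeriv hI).norm ℝ fun p hp => (hX.isRegularLoop p.2 hp.2).regular p.1

lemma isSmoothFamily_tangent (hX : IsLoopFamily I X) (hI : UniqueDiffOn ℝ I) :
    IsSmoothFamily I fun u t => tangent (fun v => X v t) u :=
  ((hX.isSmoothFamily_metric hI).inv fun p hp =>
    ((hX.isRegularLoop p.2 hp.2).metric_pos p.1).ne').smul (hX.isSmoothFamily.paramDeriv hI)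

lemma isSmoothFamily_normal (hX : IsLoopFamily I X) (hI : UniqueDiffOn ℝ I) :
    IsSmoothFamily I fun u t => normal (fun v => X v t) u :=
  rotIsometry.toContinuousLinearMap.contDiff.comp_contDiffOn (hX.isSmoothFamily_tangent hI)

lemma isSmoothFamily_curvature (hX : IsLoopFamily I X) (hI : UniqueDiffOn ℝ I) :
    IsSmoothFamily I fun u t => curvature (fun v => X v t) u :=
  (((hX.isSmoothFamily_metric hI).inv fun p hp =>
    ((hX.isRegularLoop p.2 hp.2).metric_pos p.1).ne').smul
      ((hX.isSmoothFamily_tangent hI).paramDeriv hI)).inner ℝ (hX.isSmoothFamily_normal hI)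

lemma isSmoothFamily_turningRate (hX : IsLoopFamily I X) (hI : UniqueDiffOn ℝ I) :
    IsSmoothFamily I fun u t => turningRate (fun v => X v t) u :=
  (hX.isSmoothFamily_curvature hI).mul (hX.isSmoothFamily_metric hI)

lemma continuousOn_length (hX : IsLoopFamily I X) (hI : UniqueDiffOn ℝ I) :
    ContinuousOn (fun t => length fun u => X u t) I :=
  (hX.isSmoothFamily_metric hI).continuousOn_integral _ _

lemma isSmoothFamily_inner_rot (hX : IsLoopFamily I X) (hI : UniqueDiffOn ℝ I) :
    IsSmoothFamily I fun u t => ⟪rot (X u t), paramDeriv X u t⟫ :=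
  (rotIsometry.toContinuousLinearMap.contDiff.comp_contDiffOn hX.isSmoothFamily).inner ℝ
    (hX.isSmoothFamily.paramDeriv hI)

lemma paramDeriv_eq_metric_smul_tangent (hX : IsLoopFamily J X) (ht : t ∈ J) (u : ℝ) :
    paramDeriv X u t = metric (fun v => X v t) u • tangent (fun v => X v t) u :=
  ((hX.isRegularLoop t ht).metric_smul_tangent u).symm

lemma periodic_timeDeriv (hX : IsLoopFamily J X) (hJ : IsOpen J) (ht : t ∈ J) :
    Function.Periodic (fun u => timeDeriv X u t) (2 * π) := fun u => by
  refine EventuallyEq.deriv_eq ?_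
  filter_upwards [hJ.mem_nhds ht] with τ hτ
  exact (hX.isRegularLoop τ hτ).periodic u

lemma periodic_rotationRate (hX : IsLoopFamily J X) (hJ : IsOpen J) (ht : t ∈ J) :
    Function.Periodic (fun u => rotationRate X u t) (2 * π) := fun u => by
  simp only [rotationRate, (hX.isRegularLoop t ht).periodic_metric u,
    (hX.isRegularLoop t ht).periodic_normal u]
  exact congrArg (fun v => _ * ⟪v, _⟫) (periodic_deriv (hX.periodic_timeDeriv hJ ht) u)

lemma isSmoothFamily_rotationRate (hX : IsLoopFamily J X) (hJ : IsOpen J) :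
    IsSmoothFamily J (rotationRate X) :=
  ((hX.isSmoothFamily_metric hJ.uniqueDiffOn).inv fun p hp =>
    ((hX.isRegularLoop p.2 hp.2).metric_pos p.1).ne').mul
      (((hX.isSmoothFamily.timeDeriv hJ).paramDeriv hJ.uniqueDiffOn).inner ℝ
        (hX.isSmoothFamily_normal hJ.uniqueDiffOn))

lemma hasDerivAt_metric (hX : IsLoopFamily J X) (hJ : IsOpen J) (ht : t ∈ J) (u : ℝ) :
    HasDerivAt (fun τ => metric (fun v => X v τ) u)
      ⟪tangent (fun v => X v t) u, paramDeriv (timeDeriv X) u t⟫ t := by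
  have hpos := (hX.isRegularLoop t ht).metric_pos u
  have hsq : ‖paramDeriv X u t‖ ^ 2 ≠ 0 := pow_ne_zero 2 hpos.ne'
  refine ((hX.isSmoothFamily.hasDerivAt_paramDeriv hJ ht u).norm_sq.sqrt hsq).congr_deriv ?_
    |>.congr_of_eventuallyEq (Eventually.of_forall fun τ => (Real.sqrt_sq (norm_nonneg _)).symm)
  rw [Real.sqrt_sq (norm_nonneg _), tangent, real_inner_smul_left, mul_div_mul_left _ _ two_ne_zero,
    div_eq_inv_mul]
  rfl

lemma hasDerivAt_tangent (hX : IsLoopFamily J X) (hJ : IsOpen J) (ht : t ∈ J) (u : ℝ) :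
    HasDerivAt (fun τ => tangent (fun v => X v τ) u)
      (rotationRate X u t • normal (fun v => X v t) u) t := by
  have hγ := hX.isRegularLoop t ht
  have hpos := hγ.metric_pos u
  refine (((hX.hasDerivAt_metric hJ ht u).inv hpos.ne').smul
    (hX.isSmoothFamily.hasDerivAt_paramDeriv hJ ht u)).congr_deriv ?_
  have hdecomp := inner_smul_add_inner_rot_smul (hγ.norm_tangent u) (paramDeriv (timeDeriv X) u t)
  rw [rotationRate, real_inner_comm (normal (fun v => X v t) u),
    hX.paramDeriv_eq_metric_smul_tangent ht, normal, Pi.inv_apply]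
  nth_rw 1 [← hdecomp]
  match_scalars <;> field_simp
  ring

lemma hasDerivAt_normal (hX : IsLoopFamily J X) (hJ : IsOpen J) (ht : t ∈ J) (u : ℝ) :
    HasDerivAt (fun τ => normal (fun v => X v τ) u)
      (-(rotationRate X u t • tangent (fun v => X v t) u)) t := by
  refine (hasDerivAt_rot (hX.hasDerivAt_tangent hJ ht u)).congr_deriv ?_
  rw [rot_smul, normal, rot_rot, smul_neg]

lemma hasDerivAt_turningRate (hX : IsLoopFamily J X) (hJ : IsOpen J) (ht : t ∈ J) (u : ℝ) :
    HasDerivAt (fun τ => turningRate (fun v => X v τ) u) (paramDeriv (rotationRate X) u t) t := by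
  have hγ := hX.isRegularLoop t ht
  have hT := hX.isSmoothFamily_tangent hJ.uniqueDiffOn
  have htangent : paramDeriv (timeDeriv fun u t => tangent (fun v => X v t) u) u t =
      paramDeriv (rotationRate X) u t • normal (fun v => X v t) u -
        (rotationRate X u t * turningRate (fun v => X v t) u) • tangent (fun v => X v t) u := by
    have h : (fun v => timeDeriv (fun u t => tangent (fun v => X v t) u) v t) =
        fun v => rotationRate X v t • normal (fun v => X v t) v :=
      funext fun v => (hX.hasDerivAt_tangent hJ ht v).deriv
    rw [paramDeriv, h]
    exact (((hX.isSmoothFamily_rotationRate hJ).hasDerivAt_left ht u).smul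
      (hγ.hasDerivAt_normal u)).deriv.trans (by module)
  have hmain := (hT.hasDerivAt_paramDeriv hJ ht u).inner ℝ (hX.hasDerivAt_normal hJ ht u)
  refine (hmain.congr_deriv ?_).congr_of_eventuallyEq ?_
  · rw [htangent, paramDeriv, (hγ.hasDerivAt_tangent u).deriv]
    simp only [inner_sub_left, inner_neg_right, real_inner_smul_left, real_inner_smul_right,
      hγ.inner_normal_normal]
    simp only [normal, inner_self_rot, inner_rot_self]
    ring
  · filter_upwards [hJ.mem_nhds ht] with τ hτ
    exact ((hX.isRegularLoop τ hτ).inner_deriv_tangent_normal u).symm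

lemma hasDerivAt_integral_turningRate (hX : IsLoopFamily J X) (hJ : IsOpen J) (ht : t ∈ J) :
    HasDerivAt (fun τ => ∫ u in (0 : ℝ)..2 * π, turningRate (fun v => X v τ) u) 0 t := by
  have hφ := hX.isSmoothFamily_rotationRate hJ
  refine ((hX.isSmoothFamily_turningRate hJ.uniqueDiffOn).hasDerivAt_integral hJ ht _ _).congr_deriv
    ?_
  calc ∫ u in (0 : ℝ)..2 * π, deriv (fun τ => turningRate (fun v => X v τ) u) t
      = ∫ u in (0 : ℝ)..2 * π, paramDeriv (rotationRate X) u t :=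
        intervalIntegral.integral_congr fun u _ => (hX.hasDerivAt_turningRate hJ ht u).deriv
    _ = 0 := integral_eq_zero_of_periodic_of_hasDerivAt (hX.periodic_rotationRate hJ ht)
        (hφ.hasDerivAt_left ht) ((hφ.paramDeriv hJ.uniqueDiffOn).continuous_left ht)

theorem hasDerivAt_length (hX : IsLoopFamily J X) (hJ : IsOpen J) (ht : t ∈ J) :
    HasDerivAt (fun τ => length fun u => X u τ)
      (-∫ u in (0 : ℝ)..2 * π, turningRate (fun v => X v t) u * normalSpeed X u t) t := by
  have hγ := hX.isRegularLoop t ht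
  have hV := hX.isSmoothFamily.timeDeriv hJ
  have hVc := hV.continuous_left ht
  have hV'c := (hV.paramDeriv hJ.uniqueDiffOn).continuous_left ht
  have hw := hγ.continuous_turningRate
  have hT := hγ.continuous_tangent
  have hN := hγ.continuous_normal
  have hderiv (u : ℝ) : HasDerivAt (fun v => ⟪tangent (fun v => X v t) v, timeDeriv X v t⟫)
      (⟪tangent (fun v => X v t) u, paramDeriv (timeDeriv X) u t⟫ +
        turningRate (fun v => X v t) u * normalSpeed X u t) u := by
    refine ((hγ.hasDerivAt_tangent u).inner ℝ (hV.hasDerivAt_left ht u)).congr_deriv ?_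
    rw [real_inner_smul_left, normalSpeed, real_inner_comm (timeDeriv X u t)]
  have hperiodic : Function.Periodic
      (fun v => ⟪tangent (fun v => X v t) v, timeDeriv X v t⟫) (2 * π) := fun u => by
    simp only [hγ.periodic_tangent u, hX.periodic_timeDeriv hJ ht u]
  have key := integral_eq_zero_of_periodic_of_hasDerivAt hperiodic hderiv
    (by unfold normalSpeed; fun_prop)
  rw [intervalIntegral.integral_add (Continuous.intervalIntegrable (by fun_prop) _ _)
    (Continuous.intervalIntegrable (by unfold normalSpeed; fun_prop) _ _)] at key
  refine ((hX.isSmoothFamily_metric hJ.uniqueDiffOn).hasDerivAt_integral hJ ht _ _).congr_deriv ?_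
  rw [← eq_neg_of_add_eq_zero_left key]
  exact intervalIntegral.integral_congr fun u _ => (hX.hasDerivAt_metric hJ ht u).deriv

lemma isSmoothFamily_normalSpeed (hX : IsLoopFamily J X) (hJ : IsOpen J) :
    IsSmoothFamily J (normalSpeed X) :=
  (hX.isSmoothFamily.timeDeriv hJ).inner ℝ (hX.isSmoothFamily_normal hJ.uniqueDiffOn)

theorem hasDerivAt_area (hX : IsLoopFamily J X) (hJ : IsOpen J) (ht : t ∈ J) :
    HasDerivAt (fun τ => area fun u => X u τ)
      (-∫ u in (0 : ℝ)..2 * π, metric (fun v => X v t) u * normalSpeed X u t) t := by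
  have hγ := hX.isRegularLoop t ht
  have hV := hX.isSmoothFamily.timeDeriv hJ
  have hg := hγ.continuous_metric
  have hv := (hX.isSmoothFamily_normalSpeed hJ).continuous_left ht
  have hrot := continuous_rot.comp hγ.continuous
  have hV' := (hV.paramDeriv hJ.uniqueDiffOn).continuous_left ht
  have hparam (u : ℝ) : HasDerivAt (fun v => ⟪rot (X v t), timeDeriv X v t⟫)
      (⟪rot (X u t), paramDeriv (timeDeriv X) u t⟫ +
        metric (fun v => X v t) u * normalSpeed X u t) u := by
    refine ((hasDerivAt_rot (hγ.hasDerivAt u)).inner ℝ (hV.hasDerivAt_left ht u)).congr_deriv ?_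
    rw [rot_smul, real_inner_smul_left, normalSpeed, real_inner_comm (timeDeriv X u t)]
    rfl
  have htime (u : ℝ) : timeDeriv (fun u t => ⟪rot (X u t), paramDeriv X u t⟫) u t =
      ⟪rot (X u t), paramDeriv (timeDeriv X) u t⟫ + metric (fun v => X v t) u * normalSpeed X u t -
        2 * (metric (fun v => X v t) u * normalSpeed X u t) := by
    refine ((hasDerivAt_rot (hX.isSmoothFamily.hasDerivAt_right hJ ht u)).inner ℝ
      (hX.isSmoothFamily.hasDerivAt_paramDeriv hJ ht u)).deriv.trans ?_
    rw [inner_rot_left (timeDeriv X u t), hX.paramDeriv_eq_metric_smul_tangent ht,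
      rot_smul, real_inner_smul_right, normalSpeed, normal]
    ring
  have hperiodic : Function.Periodic (fun v => ⟪rot (X v t), timeDeriv X v t⟫) (2 * π) :=
    fun u => by simp only [hγ.periodic u, hX.periodic_timeDeriv hJ ht u]
  have hzero := integral_eq_zero_of_periodic_of_hasDerivAt hperiodic hparam (by fun_prop)
  simp only [area_eq_integral_inner_rot]
  refine (((hX.isSmoothFamily_inner_rot hJ.uniqueDiffOn).hasDerivAt_integral hJ ht _ _).const_mul
    _).congr_deriv ?_
  rw [intervalIntegral.integral_congr fun u _ => htime u,
    intervalIntegral.integral_sub (Continuous.intervalIntegrable (by fun_prop) _ _)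
      (Continuous.intervalIntegrable (by fun_prop) _ _), hzero,
    intervalIntegral.integral_const_mul]
  ring

lemma hasDerivAt_normalSpeed (hX : IsLoopFamily J X) (hJ : IsOpen J) (ht : t ∈ J) (u : ℝ) :
    HasDerivAt (fun v => normalSpeed X v t)
      (metric (fun v => X v t) u * rotationRate X u t -
        turningRate (fun v => X v t) u * ⟪tangent (fun v => X v t) u, timeDeriv X u t⟫) u := by
  have hγ := hX.isRegularLoop t ht
  have hV := hX.isSmoothFamily.timeDeriv hJ
  refine ((hV.hasDerivAt_left ht u).inner ℝ (hγ.hasDerivAt_normal u)).congr_deriv ?_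
  rw [rotationRate, mul_inv_cancel_left₀ (hγ.metric_pos u).ne', inner_neg_right,
    real_inner_smul_right, real_inner_comm (timeDeriv X u t)]
  ring

lemma integral_timeDeriv_turningRate_smul (hX : IsLoopFamily J X) (hJ : IsOpen J) (ht : t ∈ J) :
    ∫ u in (0 : ℝ)..2 * π, timeDeriv (fun u t => turningRate (fun v => X v t) u • X u t) u t =
      (2 : ℝ) • ∫ u in (0 : ℝ)..2 * π,
        (turningRate (fun v => X v t) u * normalSpeed X u t) • normal (fun v => X v t) u := by
  have hγ := hX.isRegularLoop t ht
  have hφ := hX.isSmoothFamily_rotationRate hJ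
  have hV := (hX.isSmoothFamily.timeDeriv hJ).continuous_left ht
  have hw := hγ.continuous_turningRate
  have hN := hγ.continuous_normal
  have hv := (hX.isSmoothFamily_normalSpeed hJ).continuous_left ht
  have hXc := hγ.continuous
  have hφ' := (hφ.paramDeriv hJ.uniqueDiffOn).continuous_left ht
  have hparam (u : ℝ) : HasDerivAt
      (fun v => rotationRate X v t • X v t - normalSpeed X v t • tangent (fun v => X v t) v)
      (paramDeriv (rotationRate X) u t • X u t + turningRate (fun v => X v t) u • timeDeriv X u t -
        (2 : ℝ) • ((turningRate (fun v => X v t) u * normalSpeed X u t) •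
          normal (fun v => X v t) u)) u := by
    refine (((hφ.hasDerivAt_left ht u).smul (hγ.hasDerivAt u)).sub
      ((hX.hasDerivAt_normalSpeed hJ ht u).smul (hγ.hasDerivAt_tangent u))).congr_deriv ?_
    have hdecomp := inner_smul_add_inner_rot_smul (hγ.norm_tangent u) (timeDeriv X u t)
    rw [normalSpeed, real_inner_comm (normal (fun v => X v t) u), normal]
    linear_combination (norm := module) turningRate (fun v => X v t) u • hdecomp
  have hperiodic : Function.Periodic (fun v => rotationRate X v t • X v t -
      normalSpeed X v t • tangent (fun v => X v t) v) (2 * π) := fun u => by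
    simp only [hX.periodic_rotationRate hJ ht u, hγ.periodic u, hγ.periodic_tangent u, normalSpeed,
      hX.periodic_timeDeriv hJ ht u, hγ.periodic_normal u]
  have hzero := integral_eq_zero_of_periodic_of_hasDerivAt hperiodic hparam (by fun_prop)
  rw [intervalIntegral.integral_sub (Continuous.intervalIntegrable (by fun_prop) _ _)
    (Continuous.intervalIntegrable (by fun_prop) _ _), intervalIntegral.integral_smul] at hzero
  refine Eq.trans (intervalIntegral.integral_congr fun u _ => ?_) (sub_eq_zero.1 hzero)
  exact ((hX.hasDerivAt_turningRate hJ ht u).smul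
    (hX.isSmoothFamily.hasDerivAt_right hJ ht u)).deriv.trans (add_comm _ _)

theorem hasDerivAt_steinerPoint (hX : IsLoopFamily J X) (hJ : IsOpen J) (ht : t ∈ J) :
    HasDerivAt (fun τ => steinerPoint fun u => X u τ)
      (π⁻¹ • ∫ u in (0 : ℝ)..2 * π,
        (turningRate (fun v => X v t) u * normalSpeed X u t) • normal (fun v => X v t) u) t := by
  have hw : IsSmoothFamily J fun u t => turningRate (fun v => X v t) u • X u t :=
    (hX.isSmoothFamily_turningRate hJ.uniqueDiffOn).smul hX.isSmoothFamily
  refine ((hw.hasDerivAt_integral hJ ht 0 (2 * π)).const_smul (2 * π)⁻¹).congr_deriv ?_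
  rw [hX.integral_timeDeriv_turningRate_smul hJ ht, smul_smul, mul_inv, mul_right_comm,
    inv_mul_cancel₀ two_ne_zero, one_mul]

end IsLoopFamily

/-! ### Monotonicity and decay along the flow -/

namespace IsConvexLoop

variable {γ : ℝ → Plane}

lemma integral_inv_curvature_pos (hγ : IsConvexLoop γ) :
    0 < ∫ u in (0 : ℝ)..2 * π, 1 / curvature γ u * metric γ u :=
  intervalIntegral.intervalIntegral_pos_of_pos
    (((continuous_const.div hγ.continuous_curvature fun u => (hγ.curvature_pos u).ne').mul
      hγ.continuous_metric).intervalIntegrable _ _)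
    (fun u => mul_pos (one_div_pos.2 (hγ.curvature_pos u)) (hγ.metric_pos u)) Real.two_pi_pos

lemma length_sq_sub_pos (hγ : IsConvexLoop γ) : 0 < length γ ^ 2 - 2 * π * area γ := by
  have h := hγ.deficit_nonneg
  rw [deficit] at h
  linarith [mul_pos Real.pi_pos hγ.area_pos]

lemma nonlocalTerm_le (hγ : IsConvexLoop γ) :
    nonlocalTerm γ ≤ 2 * π ^ 2 / (length γ ^ 2 - 2 * π * area γ) := by
  rw [nonlocalTerm, pow_two π, ← mul_assoc]
  exact (div_le_div_of_nonneg_left Real.two_pi_pos.le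
    (div_pos hγ.length_sq_sub_pos Real.pi_pos) hγ.le_integral_inv_curvature).trans_eq
    (div_div_eq_mul_div _ _ _)

lemma nonlocalTerm_mul_length_le (hγ : IsConvexLoop γ) :
    nonlocalTerm γ * length γ ≤ 4 * π ^ 2 / length γ := by
  have hL := hγ.length_pos
  have hdeficit := hγ.deficit_nonneg
  rw [deficit] at hdeficit
  calc nonlocalTerm γ * length γ
      ≤ 2 * π ^ 2 / (length γ ^ 2 - 2 * π * area γ) * length γ := by
        gcongr
        exact hγ.nonlocalTerm_le
    _ ≤ 2 * π ^ 2 / (length γ ^ 2 / 2) * length γ := by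
        gcongr
        linarith
    _ = 4 * π ^ 2 / length γ := by
        field_simp
        norm_num

theorem two_mul_length_mul_le (hγ : IsConvexLoop γ) :
    2 * length γ * (nonlocalTerm γ * length γ - elasticEnergy γ) ≤
      -(2 * π / area γ * deficit γ) := by
  have hL := hγ.length_pos
  have hA := hγ.area_pos
  have hM := hγ.length_sq_sub_pos
  have hratio : 1 ≤ length γ ^ 2 / (length γ ^ 2 - 2 * π * area γ) := by
    rw [one_le_div hM]
    linarith [mul_pos Real.pi_pos hA]
  calc 2 * length γ * (nonlocalTerm γ * length γ - elasticEnergy γ)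
      ≤ 2 * length γ * (2 * π ^ 2 / (length γ ^ 2 - 2 * π * area γ) * length γ -
          π * length γ / area γ) := by
        gcongr
        exacts [hγ.nonlocalTerm_le, hγ.pi_mul_length_div_area_le]
    _ = -(2 * π / area γ * deficit γ *
          (length γ ^ 2 / (length γ ^ 2 - 2 * π * area γ))) := by
        rw [deficit]
        field_simp
        ring
    _ ≤ -(2 * π / area γ * deficit γ) :=
        neg_le_neg (le_mul_of_one_le_right
          (mul_nonneg (div_pos Real.two_pi_pos hA).le hγ.deficit_nonneg) hratio)

end IsConvexLoop

section Monotonicity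

variable {f f' : ℝ → ℝ} {I : Set ℝ} {s t : ℝ}

lemma eq_of_hasDerivAt_zero (hI : Convex ℝ I) (hf : ContinuousOn f I)
    (hf' : ∀ τ ∈ interior I, HasDerivAt f 0 τ) (hs : s ∈ I) (ht : t ∈ I) (hst : s ≤ t) :
    f t = f s :=
  le_antisymm
    (antitoneOn_of_hasDerivWithinAt_nonpos hI hf (fun τ hτ => (hf' τ hτ).hasDerivWithinAt)
      (fun _ _ => le_rfl) hs ht hst)
    (monotoneOn_of_hasDerivWithinAt_nonneg hI hf (fun τ hτ => (hf' τ hτ).hasDerivWithinAt)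
      (fun _ _ => le_rfl) hs ht hst)

lemma le_mul_exp_of_hasDerivAt_le {k : ℝ} (hI : Convex ℝ I) (hf : ContinuousOn f I)
    (hf' : ∀ τ ∈ interior I, HasDerivAt f (f' τ) τ)
    (hle : ∀ τ ∈ interior I, f' τ ≤ -(k * f τ)) (hs : s ∈ I) (ht : t ∈ I) (hst : s ≤ t) :
    f t ≤ f s * Real.exp (-(k * (t - s))) := by
  have hanti : AntitoneOn (fun τ => Real.exp (k * τ) * f τ) I := by
    refine antitoneOn_of_hasDerivWithinAt_nonpos hI
      ((by fun_prop : Continuous fun τ => Real.exp (k * τ)).continuousOn.mul hf)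
      (fun τ hτ => ((((hasDerivAt_id τ).const_mul k).exp).mul (hf' τ hτ)).hasDerivWithinAt)
      fun τ hτ => ?_
    have h := mul_le_mul_of_nonneg_left (hle τ hτ) (Real.exp_pos (k * τ)).le
    simp only [id]
    linarith
  have h : Real.exp (k * t) * f t ≤ Real.exp (k * s) * f s := hanti hs ht hst
  rw [show -(k * (t - s)) = k * s - k * t by ring, Real.exp_sub, mul_div_assoc',
    le_div_iff₀ (Real.exp_pos _)]
  linarith

end Monotonicity

section TimeInterval

variable {T : EReal}

lemma zero_mem_timeInterval (hT : 0 < T) : (0 : ℝ) ∈ timeInterval T :=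
  ⟨le_rfl, by exact_mod_cast hT⟩

lemma convex_timeInterval (T : EReal) : Convex ℝ (timeInterval T) :=
  OrdConnected.convex
    ⟨fun _ hs _ ht _ hr => ⟨hs.1.trans hr.1, (EReal.coe_le_coe_iff.2 hr.2).trans_lt ht.2⟩⟩

lemma uniqueDiffOn_timeInterval (hT : 0 < T) : UniqueDiffOn ℝ (timeInterval T) := by
  obtain ⟨τ, hτ, hτT⟩ := EReal.lt_iff_exists_real_btwn.1 hT
  refine uniqueDiffOn_convex (convex_timeInterval T) ((nonempty_Ioo.2 ?_).mono
    (isOpen_Ioo.subset_interior_iff.2 fun s hs =>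
      (⟨hs.1.le, (EReal.coe_lt_coe_iff.2 hs.2).trans hτT⟩ : s ∈ timeInterval T)))
  exact_mod_cast hτ

lemma timeInterval_top : timeInterval ⊤ = Ici 0 := by
  ext t
  simp [timeInterval]

end TimeInterval

namespace IsFlow

variable {T : EReal} {X : ℝ → ℝ → Plane} {s t : ℝ}

lemma isLoopFamily (hX : IsFlow T X) : IsLoopFamily (timeInterval T) X where
  isSmoothFamily := hX.smooth
  isRegularLoop t ht :=
    ⟨IsSmoothFamily.contDiff_left hX.smooth ht, hX.periodic t ht, hX.regular t ht⟩

lemma isLoopFamily_interior (hX : IsFlow T X) : IsLoopFamily (interior (timeInterval T)) X :=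
  hX.isLoopFamily.mono interior_subset

lemma normalSpeed_eq (hX : IsFlow T X) (ht : t ∈ interior (timeInterval T)) (u : ℝ) :
    normalSpeed X u t = curvature (fun v => X v t) u -
      nonlocalTerm (fun v => X v t) / curvature (fun v => X v t) u := by
  obtain ⟨η, hη⟩ := hX.evolution
  have hderiv := ((hη t (interior_subset ht) u).hasDerivAt (mem_interior_iff_mem_nhds.1 ht)).deriv
  rw [normalSpeed, timeDeriv, hderiv, inner_add_left, real_inner_smul_left, real_inner_smul_left,
    (hX.isLoopFamily_interior.isRegularLoop t ht).inner_normal_normal, normal, inner_self_rot]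
  ring

lemma curvature_pos (hT : 0 < T) (hX : IsFlow T X)
    (hX₀ : IsConvexLoop fun u => X u 0) (ht : t ∈ timeInterval T) (u : ℝ) :
    0 < curvature (fun v => X v t) u := by
  by_contra! hle
  have hcont := (hX.isLoopFamily.isSmoothFamily_curvature
    (uniqueDiffOn_timeInterval hT)).continuousOn_right u
  obtain ⟨s, hs, hzero⟩ := (convex_timeInterval T).isPreconnected.intermediate_value ht
    (zero_mem_timeInterval hT) hcont ⟨hle, (hX₀.curvature_pos u).le⟩
  exact hX.curvature_ne_zero s hs u hzero

theorem isConvexLoop (hT : 0 < T) (hX : IsFlow T X)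
    (hX₀ : IsConvexLoop fun u => X u 0) (ht : t ∈ timeInterval T) :
    IsConvexLoop fun u => X u t where
  toIsRegularLoop := hX.isLoopFamily.isRegularLoop t ht
  curvature_pos := hX.curvature_pos hT hX₀ ht
  integral_turningRate :=
    (eq_of_hasDerivAt_zero (convex_timeInterval T)
      ((hX.isLoopFamily.isSmoothFamily_turningRate
        (uniqueDiffOn_timeInterval hT)).continuousOn_integral 0 (2 * π))
      (fun _ => hX.isLoopFamily_interior.hasDerivAt_integral_turningRate isOpen_interior)
      (zero_mem_timeInterval hT) ht ht.1).trans hX₀.integral_turningRate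

lemma turningRate_mul_normalSpeed (hX : IsFlow T X) (ht : t ∈ interior (timeInterval T)) (u : ℝ) :
    turningRate (fun v => X v t) u * normalSpeed X u t =
      (curvature (fun v => X v t) u ^ 2 - nonlocalTerm fun v => X v t) *
        metric (fun v => X v t) u := by
  have hκ := hX.curvature_ne_zero t (interior_subset ht) u
  rw [hX.normalSpeed_eq ht, turningRate]
  field_simp

theorem hasDerivAt_length (hX : IsFlow T X) (ht : t ∈ interior (timeInterval T)) :
    HasDerivAt (fun τ => length fun u => X u τ)
      (nonlocalTerm (fun u => X u t) * length (fun u => X u t) - elasticEnergy fun u => X u t)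
      t := by
  have hγ := hX.isLoopFamily_interior.isRegularLoop t ht
  have hg := hγ.continuous_metric
  have hκ := hγ.continuous_curvature
  refine (hX.isLoopFamily_interior.hasDerivAt_length isOpen_interior ht).congr_deriv ?_
  simp only [hX.turningRate_mul_normalSpeed ht, sub_mul]
  rw [intervalIntegral.integral_sub (Continuous.intervalIntegrable (by fun_prop) _ _)
    (Continuous.intervalIntegrable (by fun_prop) _ _), intervalIntegral.integral_const_mul, neg_sub]
  rfl

theorem hasDerivAt_area (hT : 0 < T) (hX : IsFlow T X)
    (hX₀ : IsConvexLoop fun u => X u 0) (ht : t ∈ interior (timeInterval T)) :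
    HasDerivAt (fun τ => area fun u => X u τ) 0 t := by
  have hγ := hX.isConvexLoop hT hX₀ (interior_subset ht)
  have hg := hγ.continuous_metric
  have hw := hγ.continuous_turningRate
  have hκ : Continuous fun u => 1 / curvature (fun v => X v t) u :=
    continuous_const.div hγ.continuous_curvature fun u => (hγ.curvature_pos u).ne'
  refine (hX.isLoopFamily_interior.hasDerivAt_area isOpen_interior ht).congr_deriv ?_
  have hv (u : ℝ) : metric (fun v => X v t) u * normalSpeed X u t = turningRate (fun v => X v t) u -
      nonlocalTerm (fun v => X v t) *
        (1 / curvature (fun v => X v t) u * metric (fun v => X v t) u) := by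
    rw [hX.normalSpeed_eq ht, turningRate]
    ring
  simp only [hv]
  rw [intervalIntegral.integral_sub (Continuous.intervalIntegrable (by fun_prop) _ _)
    (Continuous.intervalIntegrable (by fun_prop) _ _), intervalIntegral.integral_const_mul,
    hγ.integral_turningRate, nonlocalTerm, div_mul_cancel₀ _ hγ.integral_inv_curvature_pos.ne',
    sub_self, neg_zero]

lemma continuousOn_area (hT : 0 < T) (hX : IsFlow T X) :
    ContinuousOn (fun t => area fun u => X u t) (timeInterval T) := by
  simp only [area_eq_integral_inner_rot]
  exact continuousOn_const.mul ((hX.isLoopFamily.isSmoothFamily_inner_rot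
    (uniqueDiffOn_timeInterval hT)).continuousOn_integral _ _)

theorem area_eq (hT : 0 < T) (hX : IsFlow T X) (hX₀ : IsConvexLoop fun u => X u 0)
    (ht : t ∈ timeInterval T) : area (fun u => X u t) = area fun u => X u 0 :=
  eq_of_hasDerivAt_zero (f := fun t => area fun u => X u t) (convex_timeInterval T)
    (hX.continuousOn_area hT) (fun _ => hX.hasDerivAt_area hT hX₀)
    (zero_mem_timeInterval hT) ht ht.1

theorem deficit_le_mul_exp (hT : 0 < T) (hX : IsFlow T X)
    (hX₀ : IsConvexLoop fun u => X u 0) (hs : s ∈ timeInterval T)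
    (ht : t ∈ timeInterval T) (hst : s ≤ t) :
    deficit (fun u => X u t) ≤ deficit (fun u => X u s) *
      Real.exp (-(2 * π / area (fun u => X u 0) * (t - s))) := by
  refine le_mul_exp_of_hasDerivAt_le (f := fun t => deficit fun u => X u t)
    (convex_timeInterval T)
    (((hX.isLoopFamily.continuousOn_length (uniqueDiffOn_timeInterval hT)).pow 2).sub
      (continuousOn_const.mul (hX.continuousOn_area hT)))
    (fun τ hτ => ((hX.hasDerivAt_length hτ).pow 2).sub
      ((hX.hasDerivAt_area hT hX₀ hτ).const_mul _)) (fun τ hτ => ?_) hs ht hst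
  have h := (hX.isConvexLoop hT hX₀ (interior_subset hτ)).two_mul_length_mul_le
  rw [hX.area_eq hT hX₀ (interior_subset hτ)] at h
  simpa using h

theorem antitoneOn_deficit (hT : 0 < T) (hX : IsFlow T X)
    (hX₀ : IsConvexLoop fun u => X u 0) :
    AntitoneOn (fun t => deficit fun u => X u t) (timeInterval T) := fun s hs t ht hst => by
  refine (hX.deficit_le_mul_exp hT hX₀ hs ht hst).trans
    (mul_le_of_le_one_right (hX.isConvexLoop hT hX₀ hs).deficit_nonneg
      (Real.exp_le_one_iff.2 (neg_nonpos.2 (mul_nonneg ?_ (sub_nonneg.2 hst)))))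
  exact (div_pos Real.two_pi_pos hX₀.area_pos).le

theorem deficit_lt (hT : 0 < T) (hX : IsFlow T X) (hX₀ : IsConvexLoop fun u => X u 0)
    (hs : s ∈ timeInterval T) (ht : t ∈ timeInterval T) (hst : s < t)
    (hpos : 0 < deficit fun u => X u s) : deficit (fun u => X u t) < deficit fun u => X u s := by
  refine (hX.deficit_le_mul_exp hT hX₀ hs ht hst.le).trans_lt (mul_lt_of_lt_one_right hpos
    (Real.exp_lt_one_iff.2 (neg_neg_of_pos (mul_pos ?_ (sub_pos.2 hst)))))
  exact div_pos Real.two_pi_pos hX₀.area_pos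

theorem deficit_le_deficit_zero_mul_exp (hT : 0 < T) (hX : IsFlow T X)
    (hX₀ : IsConvexLoop fun u => X u 0) (ht : t ∈ timeInterval T) :
    deficit (fun u => X u t) ≤ deficit (fun u => X u 0) *
      Real.exp (-(2 * π * t / area fun u => X u 0)) := by
  have h := hX.deficit_le_mul_exp hT hX₀ (zero_mem_timeInterval hT) ht ht.1
  rwa [sub_zero, div_mul_eq_mul_div] at h

theorem deficit_le_deficit_zero_mul_exp_of_half_le_length
    (hT : 0 < T) (hX : IsFlow T X) (hX₀ : IsConvexLoop fun u => X u 0)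
    (ht : t ∈ timeInterval T) (hL : 1 / 2 ≤ length fun u => X u 0) :
    deficit (fun u => X u t) ≤ deficit (fun u => X u 0) *
      Real.exp (-(π * t / (area (fun u => X u 0) * length fun u => X u 0))) := by
  have hA := hX₀.area_pos
  have hrate : π * t / (area (fun u => X u 0) * length fun u => X u 0) ≤
      2 * π * t / area fun u => X u 0 :=
    calc π * t / (area (fun u => X u 0) * length fun u => X u 0)
        ≤ π * t / (area (fun u => X u 0) * (1 / 2)) := by
          gcongr
          exact mul_nonneg Real.pi_pos.le ht.1
      _ = 2 * π * t / area fun u => X u 0 := by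
          field_simp
  exact (hX.deficit_le_deficit_zero_mul_exp hT hX₀ ht).trans (mul_le_mul_of_nonneg_left
    (Real.exp_le_exp.2 (neg_le_neg hrate)) hX₀.deficit_nonneg)

end IsFlow

/-! ### Convergence of the curves -/

lemma cauchySeq_of_dist_le {E F : Type*} [PseudoMetricSpace E] [PseudoMetricSpace F] {f : ℝ → E}
    {g : ℝ → F} {a : ℝ} (hg : CauchySeq g)
    (h : ∀ s t, a ≤ s → s ≤ t → dist (f s) (f t) ≤ dist (g s) (g t)) : CauchySeq f := by
  rw [Metric.cauchySeq_iff] at hg ⊢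
  intro ε hε
  obtain ⟨N, hN⟩ := hg ε hε
  refine ⟨max a N, fun s hs t ht => ?_⟩
  rcases le_total s t with hst | hts
  · exact (h s t (le_of_max_le_left hs) hst).trans_lt
      (hN s (le_of_max_le_right hs) t (le_of_max_le_right ht))
  · rw [dist_comm]
    exact (h t s (le_of_max_le_left ht) hts).trans_lt
      (hN t (le_of_max_le_right ht) s (le_of_max_le_right hs))

namespace IsFlow

variable {T : EReal} {X : ℝ → ℝ → Plane} {s t : ℝ}

lemma exists_hasDerivAt_steinerPoint (hT : 0 < T) (hX : IsFlow T X)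
    (hX₀ : IsConvexLoop fun u => X u 0) (ht : t ∈ interior (timeInterval T)) :
    ∃ σ', HasDerivAt (fun τ => steinerPoint fun u => X u τ) σ' t ∧
      ‖σ'‖ ≤ -(nonlocalTerm (fun u => X u t) * length (fun u => X u t) -
        elasticEnergy fun u => X u t) / π := by
  have hγ := hX.isConvexLoop hT hX₀ (interior_subset ht)
  refine ⟨_, hX.isLoopFamily_interior.hasDerivAt_steinerPoint isOpen_interior ht, ?_⟩
  simp only [hX.turningRate_mul_normalSpeed ht]
  rw [norm_smul, norm_inv, Real.norm_of_nonneg Real.pi_pos.le, inv_mul_eq_div]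
  gcongr
  linarith [hγ.norm_integral_sub_const_mul_metric_smul_normal_le (nonlocalTerm fun u => X u t),
    hγ.nonlocalTerm_mul_length_le]

theorem dist_steinerPoint_le (hT : 0 < T) (hX : IsFlow T X)
    (hX₀ : IsConvexLoop fun u => X u 0) (hst : s ≤ t)
    (hI : Icc s t ⊆ interior (timeInterval T)) :
    dist (steinerPoint fun u => X u s) (steinerPoint fun u => X u t) ≤
      (length (fun u => X u s) - length fun u => X u t) / π := by
  choose! σ' hσ' hle using fun τ (hτ : τ ∈ Icc s t) =>
    hX.exists_hasDerivAt_steinerPoint hT hX₀ (hI hτ)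
  have hlength (τ : ℝ) (hτ : τ ∈ Icc s t) :=
    ((hX.hasDerivAt_length (hI hτ)).const_sub (length fun u => X u s)).div_const π
  rw [dist_comm, dist_eq_norm]
  exact image_norm_le_of_norm_deriv_right_le_deriv_boundary'
    (f := fun τ => steinerPoint (fun u => X u τ) - steinerPoint fun u => X u s)
    (fun τ hτ => ((hσ' τ hτ).sub_const _).continuousAt.continuousWithinAt)
    (fun τ hτ => ((hσ' τ (Ico_subset_Icc_self hτ)).sub_const _).hasDerivWithinAt) (by simp)
    (fun τ hτ => (hlength τ hτ).continuousAt.continuousWithinAt)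
    (fun τ hτ => (hlength τ (Ico_subset_Icc_self hτ)).hasDerivWithinAt)
    (fun τ hτ => hle τ (Ico_subset_Icc_self hτ)) (right_mem_Icc.2 hst)

theorem tendsto_deficit (hX : IsFlow ⊤ X) (hX₀ : IsConvexLoop fun u => X u 0) :
    Tendsto (fun t => deficit fun u => X u t) atTop (𝓝 0) := by
  have hrate : 0 < 2 * π / area fun u => X u 0 :=
    div_pos Real.two_pi_pos hX₀.area_pos
  have hexp : Tendsto (fun t : ℝ => deficit (fun u => X u 0) *
      Real.exp (-(2 * π * t / area fun u => X u 0))) atTop (𝓝 0) := by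
    simpa only [mul_zero, Function.comp_def, id, div_mul_eq_mul_div] using
      (Real.tendsto_exp_neg_atTop_nhds_zero.comp
        (tendsto_id.const_mul_atTop hrate)).const_mul (deficit fun u => X u 0)
  refine squeeze_zero' ?_ ?_ hexp <;> filter_upwards [eventually_ge_atTop 0] with t ht <;>
    rw [← mem_Ici, ← timeInterval_top] at ht
  · exact (hX.isConvexLoop EReal.zero_lt_top hX₀ ht).deficit_nonneg
  · exact hX.deficit_le_deficit_zero_mul_exp EReal.zero_lt_top hX₀ ht

lemma tendsto_length (hX : IsFlow ⊤ X) (hX₀ : IsConvexLoop fun u => X u 0) :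
    Tendsto (fun t => length fun u => X u t) atTop (𝓝 √(4 * π * area fun u => X u 0)) := by
  have h := ((hX.tendsto_deficit hX₀).add_const (4 * π * area fun u => X u 0)).sqrt
  rw [zero_add] at h
  refine h.congr' ?_
  filter_upwards [eventually_ge_atTop 0] with t ht
  rw [← mem_Ici, ← timeInterval_top] at ht
  have hL := (hX.isLoopFamily.isRegularLoop t ht).length_pos
  rw [← hX.area_eq EReal.zero_lt_top hX₀ ht, deficit, sub_add_cancel, Real.sqrt_sq hL.le]

theorem exists_tendsto_steinerPoint (hX : IsFlow ⊤ X)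
    (hX₀ : IsConvexLoop fun u => X u 0) :
    ∃ c, Tendsto (fun t => steinerPoint fun u => X u t) atTop (𝓝 c) := by
  refine cauchySeq_tendsto_of_complete (cauchySeq_of_dist_le (a := 1)
    ((hX.tendsto_length hX₀).div_const π).cauchySeq fun s t hs hst => ?_)
  refine (hX.dist_steinerPoint_le EReal.zero_lt_top hX₀ hst fun τ hτ => ?_).trans ?_
  · rw [timeInterval_top, interior_Ici]
    exact zero_lt_one.trans_le (hs.trans hτ.1)
  · rw [Real.dist_eq, ← sub_div]
    exact le_abs_self _

theorem exists_tendsto_hausdorffDist (hX : IsFlow ⊤ X)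
    (hX₀ : IsConvexLoop fun u => X u 0) :
    ∃ c, Tendsto (fun t => Metric.hausdorffDist (range fun u => X u t)
      (Metric.sphere c √(area (fun u => X u 0) / π))) atTop (𝓝 0) := by
  obtain ⟨c, hc⟩ := hX.exists_tendsto_steinerPoint hX₀
  refine ⟨c, ?_⟩
  set R := √(area (fun u => X u 0) / π)
  have hR : 0 < R := Real.sqrt_pos.2 (div_pos hX₀.area_pos Real.pi_pos)
  set ε : ℝ → ℝ := fun t => 3 * √(deficit fun u => X u t) + ‖steinerPoint (fun u => X u t) - c‖
  have hε : Tendsto ε atTop (𝓝 0) := by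
    simpa using ((hX.tendsto_deficit hX₀).sqrt.const_mul 3).add (hc.sub_const c).norm
  have hbound : Tendsto (fun t => √(4 * R * ε t + ε t ^ 2)) atTop (𝓝 0) := by
    simpa using ((hε.const_mul (4 * R)).add (hε.pow 2)).sqrt
  refine squeeze_zero' (Eventually.of_forall fun _ => Metric.hausdorffDist_nonneg) ?_ hbound
  filter_upwards [eventually_ge_atTop 0] with t ht
  rw [← mem_Ici, ← timeInterval_top] at ht
  refine (hX.isConvexLoop EReal.zero_lt_top hX₀ ht).hausdorffDist_range_sphere_le hR fun u => ?_
  have h := (hX.isConvexLoop EReal.zero_lt_top hX₀ ht).abs_support_sub_le c u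
  rwa [hX.area_eq EReal.zero_lt_top hX₀ ht] at h

end IsFlow

end CurveFlow

theorem mainTheorem5 (T : EReal) (hT : 0 < T) (X : ℝ → ℝ → CurveFlow.Plane)
    (hX : CurveFlow.IsFlow T X)
    (hX₀ : CurveFlow.IsStrictlyConvexClosed (fun u => X u 0)) :
    -- the deficit decreases, strictly as long as it is positive
    AntitoneOn (fun t => CurveFlow.deficit (fun u => X u t)) (CurveFlow.timeInterval T) ∧
    (∀ s ∈ CurveFlow.timeInterval T, ∀ t ∈ CurveFlow.timeInterval T, s < t →
      0 < CurveFlow.deficit (fun u => X u s) →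
      CurveFlow.deficit (fun u => X u t) < CurveFlow.deficit (fun u => X u s)) ∧
    -- it is nonnegative and decays exponentially
    0 < CurveFlow.area (fun u => X u 0) ∧
    (∀ t ∈ CurveFlow.timeInterval T,
      0 ≤ CurveFlow.deficit (fun u => X u t) ∧
      CurveFlow.deficit (fun u => X u t) ≤ CurveFlow.deficit (fun u => X u 0) *
        Real.exp (-(2 * Real.pi * t / CurveFlow.area (fun u => X u 0))) ∧
      (1 / 2 ≤ CurveFlow.length (fun u => X u 0) →
        CurveFlow.deficit (fun u => X u t) ≤ CurveFlow.deficit (fun u => X u 0) *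
          Real.exp (-(Real.pi * t /
            (CurveFlow.area (fun u => X u 0) * CurveFlow.length (fun u => X u 0)))))) ∧
    -- if the flow exists for all times, the deficit tends to zero and the curves converge
    (T = ⊤ →
      Tendsto (fun t => CurveFlow.deficit (fun u => X u t)) atTop (𝓝 0) ∧
      ∃ c : CurveFlow.Plane,
        Tendsto (fun t => Metric.hausdorffDist (range (fun u => X u t))
            (Metric.sphere c (Real.sqrt (CurveFlow.area (fun u => X u 0) / Real.pi))))
          atTop (𝓝 0)) := by
  have h₀ := hX₀.isConvexLoop
  refine ⟨hX.antitoneOn_deficit hT h₀, fun s hs t ht hst => hX.deficit_lt hT h₀ hs ht hst,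
    h₀.area_pos, fun t ht => ⟨(hX.isConvexLoop hT h₀ ht).deficit_nonneg,
      hX.deficit_le_deficit_zero_mul_exp hT h₀ ht,
      hX.deficit_le_deficit_zero_mul_exp_of_half_le_length hT h₀ ht⟩, ?_⟩
  rintro rfl
  exact ⟨hX.tendsto_deficit h₀, hX.exists_tendsto_hausdorffDist h₀⟩
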